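/- **Theorem (measure-valued–strong uniqueness for balance laws).** Let $n,d\in\mathbb N$, $T\in(0,\infty)$, $p\in(1,\infty)$, $\mathbb T^d=(\mathbb R/2\pi\mathbb Z)^d$, $Q_T=\mathbb T^d\times[0,T)$, $\overline{Q_T}=\mathbb T^d\times[0,T]$. Sums over repeated indices $\alpha=1,\dots,d$ are understood. Let $A,F_\alpha,G:\mathbb R^n\to\mathbb R^n$ and $\eta:\mathbb R^n\to\mathbb R$ be $C^2$, $q_\alpha:\mathbb R^n\to\mathbb R$ differentiable and $P:\mathbb R^n\to\mathbb R^n$ be $C^1$, such that * (H$_1$) $A$ is one-to-one and $\nabla A(u)$ is nonsingular for all $u\in\mathbb R^n$; * (H$_2$) $\nabla\eta=G\cdot\nabla A$ and $\nabla q_\alpha=G\cdot\nabla F_\alpha$ for all $\alpha$; * (H$_3$) $\xi\cdot\big(\nabla^2\eta(u)-G(u)\cdot\nabla^2A(u)\big)\xi>0$ for all $u\in\mathbb R^n$ and $\xi\in\mathbb R^n\setminus\{0\}$; * (A$_1$) $\beta_1(|u|^p+1)-B\le\eta(u)\le\beta_2(|u|^p+1)$ for all $u$, with some constants $\beta_1,\beta_2,B>0$;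 * (A$_2$), (A$_3$) $|F_\alpha(u)|/\eta(u)\to0$ for all $\alpha$, and $|A(u)|/\eta(u)\to0$, as $|u|\to\infty$; * (A$_4$) $\frac1C(|A(u)|^r+1)-B'\le\eta(u)\le C(|A(u)|^r+1)$ for all $u$, with some exponent $r>1$ and constants $C,B'>0$; * $\eta(u)\ge0$ for all $u$. Assume moreover that either * (i) $(G(u)-G(w))\cdot(P(u)-P(w))\le0$ for all $u,w\in\mathbb R^n$, and (A$_G$): $|G(u)|/\eta(u)\to0$ as $|u|\to\infty$; or * (ii) (A$_G$) holds and (A$_P$): $|G(u)\cdot P(u)|/\eta(u)\to0$ and $|P(u)|/\eta(u)\to0$ as $|u|\to\infty$. A *dissipative measure-valued solution* $(u,\nu,\gamma)$ with initial data $(\nu_0,\gamma_0)$ of $$\partial_tA(u)+\partial_\alpha F_\alpha(u)=P(u),\qquad \partial_t\eta(u)+\partial_\alpha q_\alpha(u)\le G(u)\cdot P(u)$$ consists of $u\in L^\infty(0,T;L^p(\mathbb T^d;\mathbb R^n))$, measurable families $\nu=(\nu_{x,t})$ and $\nu_0=(\nu_{0,x})$ of probability measures on $\mathbb R^n$, and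 non-negative Radon measures $\gamma$ on $Q_T$ and $\gamma_0$ on $\mathbb T^d$, such that $u(x,t)=\langle\nu_{x,t},\lambda\rangle$ for almost every $(x,t)\in Q_T$; the pairings $\langle\nu,A\rangle,\langle\nu,F_\alpha\rangle,\langle\nu,P\rangle,\langle\nu,\eta\rangle,\langle\nu,G\cdot P\rangle$ are defined almost everywhere and integrable on $Q_{T'}$ for every $T'<T$, and $\langle\nu_0,A\rangle,\langle\nu_0,\eta\rangle$ are defined almost everywhere and integrable on $\mathbb T^d$; $$\iint_{Q_T}\langle\nu_{x,t},A\rangle\,\partial_t\varphi+\langle\nu_{x,t},F_\alpha\rangle\,\partial_\alpha\varphi+\langle\nu_{x,t},P\rangle\,\varphi\;dx\,dt+\int_{\mathbb T^d}\langle\nu_{0,x},A\rangle\,\varphi(x,0)\,dx=0$$ for all $\varphi\in C^1_c(\mathbb T^d\times[0,T))$; and $$\iint_{Q_T}\frac{d\xi}{dt}\big[\langle\nu_{x,t},\eta\rangle\,dx\,dt+\gamma(dx\,dt)\big]+\int_{\mathbb T^d}\xi(0)\big[\langle\nu_{0,x},\eta\rangle\,dx+\gamma_0(dx)\big]+\iint_{Q_T}\xi\,\langle\nu_{x,t},G\cdot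 P\rangle\,dx\,dt\ge0$$ for all $\xi=\xi(t)\in C^1_c([0,T))$ with $\xi\ge0$. Let $(u,\nu,\gamma)$ be such a solution, and let $\bar u\in W^{1,\infty}(\overline{Q_T};\mathbb R^n)$ (that is, $\bar u$ is Lipschitz on $\overline{Q_T}$) be a strong solution: $\partial_tA(\bar u)+\partial_\alpha F_\alpha(\bar u)=P(\bar u)$ almost everywhere on $Q_T$ (and hence also $\partial_t\eta(\bar u)+\partial_\alpha q_\alpha(\bar u)=G(\bar u)\cdot P(\bar u)$). If $\gamma_0=0$ and $\nu_{0,x}=\delta_{\bar u(x,0)}$ for almost every $x\in\mathbb T^d$, then $\nu_{x,t}=\delta_{\bar u(x,t)}$ and $u(x,t)=\bar u(x,t)$ for almost every $(x,t)\in Q_T$. -/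

import Mathlib

open MeasureTheory ProbabilityTheory Filter Set Asymptotics
open scoped ENNReal NNReal Topology

namespace BalanceLaw

noncomputable section

/-- The state space `ℝⁿ` with its Euclidean norm. -/
abbrev State (n : ℕ) : Type := EuclideanSpace ℝ (Fin n)

instance fact_two_pi_pos : Fact (0 < 2 * Real.pi) := ⟨Real.two_pi_pos⟩

/-- The flat torus `𝕋ᵈ = (ℝ/2πℤ)ᵈ`; its `volume` is Lebesgue measure, of total mass `(2π)ᵈ`. -/
abbrev Torus (d : ℕ) : Type := Fin d → AddCircle (2 * Real.pi)

/-- The covering map `ℝᵈ → 𝕋ᵈ`. -/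
def Torus.mk {d : ℕ} (y : Fin d → ℝ) : Torus d := fun i => (y i : AddCircle (2 * Real.pi))

/-- The partial derivative `∂_α f (x)` of a function on the torus. -/
def pderiv {d : ℕ} {V : Type*} [NormedAddCommGroup V] [NormedSpace ℝ V]
    (α : Fin d) (f : Torus d → V) (x : Torus d) : V :=
  deriv (fun h : ℝ => f (x + Pi.single α (h : AddCircle (2 * Real.pi)))) 0

/-- `Q_T = 𝕋ᵈ × [0, T)`. -/
def cyl (d : ℕ) (T : ℝ) : Set (Torus d × ℝ) := univ ×ˢ Ico 0 T

/-! ### The constitutive functions -/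

/-- The structural hypotheses on the fluxes `A`, `F_α` and the entropy pair `η`, `q_α` with
multiplier `G`. -/
structure EntropyStructure {n d : ℕ} (A : State n → State n) (F : Fin d → State n → State n)
    (η : State n → ℝ) (q : Fin d → State n → ℝ) (G : State n → State n) : Prop where
  contDiff_A : ContDiff ℝ 2 A
  contDiff_F : ∀ α, ContDiff ℝ 2 (F α)
  contDiff_G : ContDiff ℝ 2 G
  contDiff_η : ContDiff ℝ 2 η
  differentiable_q : ∀ α, Differentiable ℝ (q α)
  /-- `A` is one-to-one. -/
  injective_A : Function.Injective A
  /-- `∇A(u)` is nonsingular. -/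
  nonsingular : ∀ u, (fderiv ℝ A u).det ≠ 0
  /-- `∇η = G · ∇A`. -/
  grad_η : ∀ u ξ, fderiv ℝ η u ξ = inner ℝ (G u) (fderiv ℝ A u ξ)
  /-- `∇q_α = G · ∇F_α`. -/
  grad_q : ∀ α u ξ, fderiv ℝ (q α) u ξ = inner ℝ (G u) (fderiv ℝ (F α) u ξ)
  /-- `∇²η(u) - G(u) · ∇²A(u)` is positive definite. -/
  pos_def : ∀ u ξ, ξ ≠ 0 →
    0 < fderiv ℝ (fderiv ℝ η) u ξ ξ - inner ℝ (G u) (fderiv ℝ (fderiv ℝ A) u ξ ξ)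

/-- The growth hypotheses on `η`, `F_α` and `A`, with exponent `p` for `η` as a function of `u`. -/
structure GrowthConditions {n d : ℕ} (p : ℝ) (A : State n → State n)
    (F : Fin d → State n → State n) (η : State n → ℝ) : Prop where
  /-- `β₁ (|u|^p + 1) - B ≤ η(u) ≤ β₂ (|u|^p + 1)`. -/
  growth_η : ∃ β₁ β₂ B : ℝ, 0 < β₁ ∧ 0 < β₂ ∧ 0 < B ∧
    ∀ u, β₁ * (‖u‖ ^ p + 1) - B ≤ η u ∧ η u ≤ β₂ * (‖u‖ ^ p + 1)
  /-- `|F_α(u)| / η(u) → 0` as `|u| → ∞`. -/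
  growth_F : ∀ α, F α =o[Bornology.cobounded (State n)] η
  /-- `|A(u)| / η(u) → 0` as `|u| → ∞`. -/
  growth_A : A =o[Bornology.cobounded (State n)] η
  /-- `C⁻¹ (|A(u)|^r + 1) - B ≤ η(u) ≤ C (|A(u)|^r + 1)` for some exponent `r > 1`. -/
  growth_H : ∃ r C B : ℝ, 1 < r ∧ 0 < C ∧ 0 < B ∧
    ∀ u, 1 / C * (‖A u‖ ^ r + 1) - B ≤ η u ∧ η u ≤ C * (‖A u‖ ^ r + 1)

/-- The production `P` is weakly dissipative with respect to the multiplier `G`. -/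
def WeaklyDissipative {n : ℕ} (G P : State n → State n) : Prop :=
  ∀ u w, inner ℝ (G u - G w) (P u - P w) ≤ 0

/-- `|G(u)| / η(u) → 0` as `|u| → ∞`. -/
def GrowthG {n : ℕ} (G : State n → State n) (η : State n → ℝ) : Prop :=
  G =o[Bornology.cobounded (State n)] η

/-- `|G(u) · P(u)| / η(u) → 0` and `|P(u)| / η(u) → 0` as `|u| → ∞`. -/
def GrowthP {n : ℕ} (G P : State n → State n) (η : State n → ℝ) : Prop :=
  (fun u => (inner ℝ (G u) (P u) : ℝ)) =o[Bornology.cobounded (State n)] η ∧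
    P =o[Bornology.cobounded (State n)] η

/-! ### Strong solutions -/

/-- `ū ∈ W^{1,∞}(𝕋ᵈ × [0, T])`, i.e. `ū` is Lipschitz up to the boundary, and
`∂_t A(ū) + ∂_α F_α(ū) = P(ū)` almost everywhere on `Q_T`. The entropy identity
`∂_t η(ū) + ∂_α q_α(ū) = G(ū) · P(ū)` is then a consequence of the chain rule. -/
structure IsStrongSolution {n d : ℕ} (T : ℝ) (A : State n → State n)
    (F : Fin d → State n → State n) (P : State n → State n)
    (ubar : Torus d → ℝ → State n) : Prop where
  lipschitz : ∃ K : ℝ≥0,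
    LipschitzOnWith K (fun z : Torus d × ℝ => ubar z.1 z.2) (univ ×ˢ Icc 0 T)
  equation : ∀ᵐ z ∂(volume.restrict (cyl d T)),
    deriv (fun s => A (ubar z.1 s)) z.2 + ∑ α, pderiv α (fun y => F α (ubar y z.2)) z.1
      = P (ubar z.1 z.2)

/-! ### Measure-valued solutions -/

/-- Test functions `φ ∈ C¹_c(𝕋ᵈ × [0, T))` (not necessarily zero at `t = 0`), as restrictions of
`C¹` functions on `𝕋ᵈ × ℝ`. -/
structure IsTest {d : ℕ} (T : ℝ) (φ : Torus d → ℝ → ℝ) : Prop where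
  contDiff : ContDiff ℝ 1 (fun y : (Fin d → ℝ) × ℝ => φ (Torus.mk y.1) y.2)
  support : ∃ T' < T, ∀ x, ∀ t ≥ T', φ x t = 0

/-- Nonnegative test functions `ξ ∈ C¹_c([0, T))` of time, as restrictions of `C¹` functions
on `ℝ`. -/
structure IsTimeTest (T : ℝ) (ξ : ℝ → ℝ) : Prop where
  contDiff : ContDiff ℝ 1 ξ
  support : ∃ T' < T, ∀ t ≥ T', ξ t = 0
  nonneg : ∀ t ≥ 0, 0 ≤ ξ t

/-- The function `z ↦ ⟨ν_z, f⟩ = ∫ f(w) dν_z(w)`. -/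
def avg {X : Type*} [MeasurableSpace X] {n : ℕ} {V : Type*} [NormedAddCommGroup V]
    [NormedSpace ℝ V] (ν : Kernel X (State n)) (f : State n → V) (z : X) : V :=
  ∫ w, f w ∂(ν z)

/-- The pairing `⟨ν, f⟩` is defined `μ`-almost everywhere and is a `μ`-integrable function. -/
def AvgIntegrable {X : Type*} [MeasurableSpace X] {n : ℕ} {V : Type*} [NormedAddCommGroup V]
    [NormedSpace ℝ V] (μ : Measure X) (ν : Kernel X (State n)) (f : State n → V) : Prop :=
  (∀ᵐ z ∂μ, Integrable f (ν z)) ∧ Integrable (avg ν f) μ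

/-- `(u, ν, γ)` is a dissipative measure-valued solution with concentration, with initial data
`(ν₀, γ₀)`, of the balance law `∂_t A(u) + ∂_α F_α(u) = P(u)` with the entropy condition
`∂_t η(u) + ∂_α q_α(u) ≤ G(u) · P(u)`.
The Young measures `ν` and `ν₀` are measurable families of probability measures on `ℝⁿ`; only the
values of `ν` and `γ` on `Q_T` matter. -/
structure IsDissipativeMVSolution {n d : ℕ} (T p : ℝ) (A : State n → State n)
    (F : Fin d → State n → State n) (P : State n → State n) (η : State n → ℝ)
    (G : State n → State n)
    (u : Torus d → ℝ → State n) (ν : Kernel (Torus d × ℝ) (State n))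
    (γ : Measure (Torus d × ℝ)) (ν₀ : Kernel (Torus d) (State n))
    (γ₀ : Measure (Torus d)) : Prop where
  markov : IsMarkovKernel ν
  markov₀ : IsMarkovKernel ν₀
  /-- `γ` is a (nonnegative) Radon measure on `Q_T`. -/
  radon : ∀ T' < T, γ (univ ×ˢ Icc 0 T') < ∞
  /-- `γ₀` is a (nonnegative) Radon measure on `𝕋ᵈ`. -/
  radon₀ : IsFiniteMeasure γ₀
  /-- `u ∈ L^∞(0, T; L^p(𝕋ᵈ))`. -/
  bound_u : ∃ M : ℝ≥0, ∀ᵐ t ∂(volume.restrict (Ioo 0 T)),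
    MemLp (fun x => u x t) (ENNReal.ofReal p) volume ∧
      eLpNorm (fun x => u x t) (ENNReal.ofReal p) volume ≤ M
  /-- `u(x, t) = ⟨ν_{x,t}, λ⟩`. -/
  mean : ∀ᵐ z ∂(volume.restrict (cyl d T)),
    Integrable (fun w => w) (ν z) ∧ u z.1 z.2 = avg ν (fun w => w) z
  /-- The pairings in the averaged equations are well defined. -/
  integrable_A : ∀ T' < T, AvgIntegrable (volume.restrict (cyl d T')) ν A
  integrable_F : ∀ T' < T, ∀ α, AvgIntegrable (volume.restrict (cyl d T')) ν (F α)
  integrable_P : ∀ T' < T, AvgIntegrable (volume.restrict (cyl d T')) ν P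
  integrable_η : ∀ T' < T, AvgIntegrable (volume.restrict (cyl d T')) ν η
  integrable_GP : ∀ T' < T,
    AvgIntegrable (volume.restrict (cyl d T')) ν (fun w => (inner ℝ (G w) (P w) : ℝ))
  integrable_A₀ : AvgIntegrable volume ν₀ A
  integrable_η₀ : AvgIntegrable volume ν₀ η
  /-- The averaged balance law, as an identity in `ℝⁿ`. -/
  equation : ∀ φ : Torus d → ℝ → ℝ, IsTest T φ →
    (∫ z in cyl d T, deriv (φ z.1) z.2 • avg ν A z)
      + (∫ z in cyl d T, ∑ α, pderiv α (fun y => φ y z.2) z.1 • avg ν (F α) z)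
      + (∫ z in cyl d T, φ z.1 z.2 • avg ν P z)
      + (∫ x, φ x 0 • avg ν₀ A x) = 0
  /-- The averaged entropy inequality, integrated in space, with concentrations. -/
  entropy : ∀ ξ : ℝ → ℝ, IsTimeTest T ξ →
    0 ≤ (∫ z in cyl d T, deriv ξ z.2 * avg ν η z)
      + (∫ z in cyl d T, deriv ξ z.2 ∂γ)
      + ξ 0 * ((∫ x, avg ν₀ η x) + γ₀.real univ)
      + (∫ z in cyl d T, ξ z.2 * avg ν (fun w => (inner ℝ (G w) (P w) : ℝ)) z)

end

end BalanceLaw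

/-! The proof is the relative entropy method, averaged against the Young measure. By the growth
conditions and nonsingularity, `A` is a diffeomorphism of `ℝⁿ` (`exists_homeomorph_A`). In the
conserved variable `v = A(u)` the system reads `∂_t v + ∂_α f_α(v) = P(v)`, the entropy `H = η ∘
A⁻¹` has gradient `g = G ∘ A⁻¹`, and the Hessian `Dg` is positive definite
(`EntropyStructure.conserved`).

The relative entropy `H(w | v) = H(w) - H(v) - g(v)·(w - v)` is at least `c|w - v|²` on bounded sets
and at least `(1 + H(w))/8` for large `w`, uniformly for bounded `v`. Hence every quantity that is
quadratic in `w - v` locally and of size `1 + H(w)` globally is at most a multiple of it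
(`exists_le_relEntropy`): the Taylor remainders of `f_α` and `g`, and the production term.

Let `V = A(ū)`. Testing the averaged balance law with `ξ(t) g(V)`, which is only Lipschitz, and
combining it with the entropy inequality and with exact identities for `V`, leaves `0 ≤ ∬ (ξ' + Cξ)
⟨μ, H(· | V)⟩ + ∬ ξ' dγ` without initial term, because the initial data agree
(`exists_relEntropy_inequality`). The linear terms cancel because `Dg` and `Dg·Df_α` are symmetric,
being Hessians of `H` and, up to a symmetric term, of `q_α`.

A nonincreasing weight `ξ` with `ξ' + Cξ < 0` before a time `T'` then forces `⟨μ, H(· | V)⟩ = 0`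
there (`ae_eq_zero_of_weak_inequality`), the concentration measure entering with a favourable sign.
By strict convexity `μ` is the Dirac mass at `V`, and `A⁻¹` carries this back to `ν`.

Mollification on the covering space serves to extend the weak formulation from `C¹` to Lipschitz
test functions (`IsWeakBalance.lipschitz_test`). -/

namespace BalanceLaw

/-! ### Mollification of Lipschitz functions -/

section Mollification

set_option linter.unusedSectionVars false

variable {E : Type*} [NormedAddCommGroup E] [NormedSpace ℝ E] [FiniteDimensional ℝ E]
  [MeasurableSpace E] [BorelSpace E]

/-- Smooth bumps at the origin of radius tending to `0`. -/
noncomputable def shrinkingBump (k : ℕ) : ContDiffBump (0 : E) where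
  rIn := 1 / ((k : ℝ) + 1)
  rOut := 2 / ((k : ℝ) + 1)
  rIn_pos := by positivity
  rIn_lt_rOut := by gcongr; norm_num

lemma tendsto_shrinkingBump_rOut :
    Tendsto (fun k => (shrinkingBump k : ContDiffBump (0 : E)).rOut) atTop (𝓝 0) := by
  have h := (tendsto_one_div_add_atTop_nhds_zero_nat (𝕜 := ℝ)).const_mul 2
  simp only [mul_zero] at h
  refine h.congr fun k => ?_
  simp only [shrinkingBump]
  ring

/-- The regularization of `f` at scale `1 / (k + 1)`. -/
noncomputable def mollify (μ : Measure E) (f : E → ℝ) (k : ℕ) (x : E) : ℝ :=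
  ∫ y, (shrinkingBump k : ContDiffBump (0 : E)).normed μ y * f (x - y) ∂μ

variable {μ : Measure E} {f : E → ℝ} {K : ℝ≥0}

lemma mollify_eq_convolution (μ : Measure E) (f : E → ℝ) (k : ℕ) :
    mollify μ f k = convolution ((shrinkingBump k : ContDiffBump (0 : E)).normed μ) f
      (ContinuousLinearMap.lsmul ℝ ℝ) μ := by
  ext x
  simp [mollify, convolution]

variable [μ.IsAddHaarMeasure]

lemma integrable_bump_mul (hf : Continuous f) (k : ℕ) (x : E) :
    Integrable (fun y => (shrinkingBump k : ContDiffBump (0 : E)).normed μ y * f (x - y)) μ := by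
  refine Continuous.integrable_of_hasCompactSupport ?_ ?_
  · exact (ContDiffBump.continuous_normed _).mul (by fun_prop)
  · exact (ContDiffBump.hasCompactSupport_normed _).mul_right

lemma contDiff_mollify (hf : Continuous f) (k : ℕ) : ContDiff ℝ 1 (mollify μ f k) := by
  rw [mollify_eq_convolution]
  exact HasCompactSupport.contDiff_convolution_left (n := 1) _
    (ContDiffBump.hasCompactSupport_normed _) (ContDiffBump.contDiff_normed _)
    hf.locallyIntegrable

lemma abs_mollify_le {M : ℝ} (hM : ∀ x, |f x| ≤ M) (k : ℕ) (x : E) :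
    |mollify μ f k x| ≤ M := by
  set φ := (shrinkingBump k : ContDiffBump (0 : E))
  calc |mollify μ f k x| ≤ ∫ y, φ.normed μ y * M ∂μ := by
        rw [← Real.norm_eq_abs]
        refine norm_integral_le_of_norm_le (φ.integrable_normed.mul_const _) ?_
        filter_upwards with y
        rw [Real.norm_eq_abs, abs_mul, abs_of_nonneg (φ.nonneg_normed y)]
        exact mul_le_mul_of_nonneg_left (hM _) (φ.nonneg_normed y)
    _ = M := by rw [integral_mul_const, φ.integral_normed, one_mul]

lemma lipschitzWith_mollify (hf : LipschitzWith K f) (k : ℕ) :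
    LipschitzWith K (mollify μ f k) := by
  set φ := (shrinkingBump k : ContDiffBump (0 : E))
  refine LipschitzWith.of_dist_le_mul fun x y => ?_
  rw [Real.dist_eq, mollify, mollify,
    ← integral_sub (integrable_bump_mul hf.continuous k x) (integrable_bump_mul hf.continuous k y)]
  calc _ ≤ ∫ z, φ.normed μ z * (K * dist x y) ∂μ := by
        rw [← Real.norm_eq_abs]
        refine norm_integral_le_of_norm_le (φ.integrable_normed.mul_const _) ?_
        filter_upwards with z
        rw [← mul_sub, Real.norm_eq_abs, abs_mul, abs_of_nonneg (φ.nonneg_normed z)]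
        refine mul_le_mul_of_nonneg_left ?_ (φ.nonneg_normed z)
        have := hf.dist_le_mul (x - z) (y - z)
        rwa [dist_sub_right, Real.dist_eq] at this
    _ = K * dist x y := by rw [integral_mul_const, φ.integral_normed, one_mul]

lemma tendsto_mollify (hf : Continuous f) (x : E) :
    Tendsto (fun k => mollify μ f k x) atTop (𝓝 (f x)) := by
  simp_rw [mollify_eq_convolution]
  refine ContDiffBump.convolution_tendsto_right (g := fun _ => f) (k := fun _ => x)
    tendsto_shrinkingBump_rOut (.of_forall fun _ => hf.aestronglyMeasurable) ?_ tendsto_const_nhds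
  exact (hf.tendsto x).comp tendsto_snd

/-- Differentiation under the integral: difference quotients of `f` are at most `K‖v‖`, and they
converge for almost every `y` by Rademacher's theorem, since `y ↦ x - y` pulls null sets back to
null sets. -/
lemma lineDeriv_mollify (hf : LipschitzWith K f) (k : ℕ) (x v : E) :
    lineDeriv ℝ (mollify μ f k) x v = mollify μ (fun y => lineDeriv ℝ f y v) k x := by
  set φ := (shrinkingBump k : ContDiffBump (0 : E))
  refine HasLineDerivAt.lineDeriv ?_
  have key := hasDerivAt_integral_of_dominated_loc_of_lip (μ := μ) (𝕜 := ℝ) (E := ℝ)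
    (bound := fun y => φ.normed μ y * (K * ‖v‖))
    (F := fun (t : ℝ) y => φ.normed μ y * f (x + t • v - y)) (x₀ := 0)
    (F' := fun y => φ.normed μ y * lineDeriv ℝ f (x - y) v) (s := univ) univ_mem
    (.of_forall fun t => (integrable_bump_mul hf.continuous k _).aestronglyMeasurable)
    (integrable_bump_mul hf.continuous k _) ?_ ?_ (φ.integrable_normed.mul_const _) ?_
  · exact key.2
  · refine (φ.continuous_normed.aestronglyMeasurable).mul ?_
    exact ((measurable_lineDeriv hf.continuous).comp
      (measurable_const.sub measurable_id)).aestronglyMeasurable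
  · filter_upwards with y
    refine LipschitzOnWith.of_dist_le_mul fun s _ t _ => ?_
    rw [Real.dist_eq, ← mul_sub, abs_mul, abs_of_nonneg (φ.nonneg_normed y), Real.coe_nnabs,
      abs_of_nonneg (mul_nonneg (φ.nonneg_normed y) (by positivity)), mul_assoc]
    refine mul_le_mul_of_nonneg_left ?_ (φ.nonneg_normed y)
    have := hf.dist_le_mul (x + s • v - y) (x + t • v - y)
    rw [dist_sub_right, dist_add_left, dist_eq_norm (s • v), ← sub_smul, norm_smul,
      ← dist_eq_norm s t, Real.dist_eq (f _)] at this
    linarith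
  · have h1 : ∀ᵐ y ∂μ, LineDifferentiableAt ℝ f (x - y) v :=
      (quasiMeasurePreserving_sub_left μ x).ae (hf.ae_lineDifferentiableAt v)
    filter_upwards [h1] with y hy
    have := hy.hasLineDerivAt
    rw [HasLineDerivAt] at this
    have h2 := this.const_mul (φ.normed μ y)
    refine h2.congr_of_eventuallyEq (.of_forall fun t => ?_)
    simp only
    congr 2
    abel

/-- Lebesgue differentiation applied to the bounded function `lineDeriv ℝ f · v`. It needs the outer
radius of the bumps to stay within a fixed multiple of the inner one, here `2`. -/
lemma ae_tendsto_lineDeriv_mollify (hf : LipschitzWith K f) (v : E) :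
    ∀ᵐ x ∂μ, Tendsto (fun k => lineDeriv ℝ (mollify μ f k) x v) atTop
      (𝓝 (lineDeriv ℝ f x v)) := by
  simp_rw [lineDeriv_mollify hf, mollify_eq_convolution]
  refine ContDiffBump.ae_convolution_tendsto_right_of_locallyIntegrable (K := 2)
    tendsto_shrinkingBump_rOut (.of_forall fun k => ?_) (hf.locallyIntegrable_lineDeriv v)
  simp only [shrinkingBump]
  exact le_of_eq (by ring)

/-- Periodicity survives mollification, so the regularization descends from the covering space to
the torus. -/
lemma mollify_add_period {a : E} (ha : ∀ x, f (x + a) = f x) (k : ℕ) (x : E) :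
    mollify μ f k (x + a) = mollify μ f k x := by
  simp only [mollify, add_sub_right_comm, ha]

end Mollification

/-! ### Calculus on the torus -/

section TorusCalculus

set_option linter.unusedSectionVars false

variable {d : ℕ} {V : Type*} [NormedAddCommGroup V] [NormedSpace ℝ V]

instance isAddHaarMeasure_cover :
    (volume : Measure ((Fin d → ℝ) × ℝ)).IsAddHaarMeasure :=
  inferInstanceAs ((volume : Measure (Fin d → ℝ)).prod (volume : Measure ℝ)).IsAddHaarMeasure

lemma Torus.mk_add_single (y : Fin d → ℝ) (α : Fin d) (h : ℝ) :
    Torus.mk (y + h • Pi.single α 1) = Torus.mk y + Pi.single α (h : AddCircle (2 * Real.pi)) := by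
  ext i
  rcases eq_or_ne i α with rfl | hi
  · simp [Torus.mk]
  · simp [Torus.mk, hi]

lemma Torus.mk_add_period (y : Fin d → ℝ) (m : Fin d → ℤ) :
    Torus.mk (y + fun i => (m i : ℝ) * (2 * Real.pi)) = Torus.mk y := by
  ext i
  simp [Torus.mk]

/-- The representative in `(0, 2π]ᵈ` of a point of the torus. -/
noncomputable def Torus.rep (x : Torus d) : Fin d → ℝ :=
  fun i => (AddCircle.equivIoc (2 * Real.pi) 0 (x i) : ℝ)

@[simp] lemma Torus.mk_rep (x : Torus d) : Torus.mk (Torus.rep x) = x := by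
  ext i
  exact (AddCircle.equivIoc (2 * Real.pi) 0).symm_apply_apply (x i)

lemma Torus.exists_period (y : Fin d → ℝ) :
    ∃ m : Fin d → ℤ, y = Torus.rep (Torus.mk y) + fun i => (m i : ℝ) * (2 * Real.pi) := by
  have h : ∀ i, ∃ m : ℤ, y i = Torus.rep (Torus.mk y) i + (m : ℝ) * (2 * Real.pi) := by
    intro i
    have h1 : ((y i - Torus.rep (Torus.mk y) i : ℝ) : AddCircle (2 * Real.pi)) = 0 := by
      have := congrFun (Torus.mk_rep (Torus.mk y)) i
      simp only [Torus.mk] at this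
      rw [AddCircle.coe_sub]
      exact sub_eq_zero.2 this.symm
    obtain ⟨m, hm⟩ := (AddCircle.coe_eq_zero_iff _).1 h1
    refine ⟨m, ?_⟩
    simp only [zsmul_eq_mul] at hm
    linarith
  choose m hm using h
  exact ⟨m, funext hm⟩

/-- Each coordinate of `Torus.rep` carries the measure of the circle to Lebesgue measure on `(0,
2π]`, so null sets of the cover pull back to null sets. Almost everywhere statements on `ℝᵈ × ℝ`
thereby pass to the torus. -/
lemma Torus.quasiMeasurePreserving_rep :
    Measure.QuasiMeasurePreserving (fun z : Torus d × ℝ => (Torus.rep z.1, z.2)) := by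
  have h1 : MeasurePreserving
      (fun x : AddCircle (2 * Real.pi) => (AddCircle.equivIoc (2 * Real.pi) 0 x : ℝ)) volume
      (volume.restrict (Ioc 0 (0 + 2 * Real.pi))) :=
    (measurePreserving_subtype_coe measurableSet_Ioc).comp
      (AddCircle.measurePreserving_equivIoc (2 * Real.pi) (a := 0))
  have h2 := measurePreserving_pi (fun _ : Fin d => (volume : Measure (AddCircle (2 * Real.pi))))
    (fun _ => volume.restrict (Ioc 0 (0 + 2 * Real.pi))) (fun _ => h1)
  have h3 := h2.prod (MeasurePreserving.id (volume : Measure ℝ))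
  refine ⟨h3.measurable, h3.map_eq.absolutelyContinuous.trans ?_⟩
  refine Measure.AbsolutelyContinuous.prod ?_ .rfl
  rw [← Measure.restrict_pi_pi]
  exact Measure.restrict_le_self.absolutelyContinuous

lemma ae_of_ae_cover {p : Torus d × ℝ → Prop}
    (h : ∀ᵐ y : (Fin d → ℝ) × ℝ, p (Torus.mk y.1, y.2)) : ∀ᵐ z, p z := by
  filter_upwards [Torus.quasiMeasurePreserving_rep.ae h] with z hz
  simpa using hz

lemma Torus.lipschitzWith_cover :
    LipschitzWith 1 (fun y : (Fin d → ℝ) × ℝ => (Torus.mk y.1, y.2)) := by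
  refine LipschitzWith.of_dist_le_mul fun x y => ?_
  rw [NNReal.coe_one, one_mul, Prod.dist_eq, Prod.dist_eq]
  refine max_le_max ?_ le_rfl
  refine (dist_pi_le_iff dist_nonneg).2 fun i => ?_
  refine le_trans ?_ (dist_le_pi_dist x.1 y.1 i)
  simp only [Torus.mk]
  rw [dist_eq_norm, dist_eq_norm, ← AddCircle.coe_sub]
  exact QuotientAddGroup.norm_mk_le_norm

lemma lineDeriv_cover_time (f : Torus d → ℝ → V) (y : (Fin d → ℝ) × ℝ) :
    lineDeriv ℝ (fun y : (Fin d → ℝ) × ℝ => f (Torus.mk y.1) y.2) y (0, 1)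
      = deriv (f (Torus.mk y.1)) y.2 := by
  have := deriv_comp_const_add (f (Torus.mk y.1)) y.2 0
  simp only [add_zero] at this
  simp [lineDeriv, this]

lemma lineDeriv_cover_space (f : Torus d → ℝ → V) (α : Fin d) (y : (Fin d → ℝ) × ℝ) :
    lineDeriv ℝ (fun y : (Fin d → ℝ) × ℝ => f (Torus.mk y.1) y.2) y (Pi.single α 1, 0)
      = pderiv α (fun x => f x y.2) (Torus.mk y.1) := by
  simp [lineDeriv, pderiv, Torus.mk_add_single]

variable {f : Torus d → ℝ → V} {K : ℝ≥0}

lemma lipschitzWith_time (hf : LipschitzWith K (fun z : Torus d × ℝ => f z.1 z.2)) (x : Torus d) :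
    LipschitzWith K (f x) := by
  refine LipschitzWith.of_dist_le_mul fun s t => ?_
  simpa [Prod.dist_eq] using hf.dist_le_mul (x, s) (x, t)

lemma lipschitzWith_space (hf : LipschitzWith K (fun z : Torus d × ℝ => f z.1 z.2)) (t : ℝ) :
    LipschitzWith K (fun x => f x t) := by
  refine LipschitzWith.of_dist_le_mul fun x y => ?_
  simpa [Prod.dist_eq] using hf.dist_le_mul (x, t) (y, t)

lemma lipschitzWith_shift {g : Torus d → V} (hg : LipschitzWith K g) (α : Fin d) (x : Torus d) :
    LipschitzWith K (fun h : ℝ => g (x + Pi.single α (h : AddCircle (2 * Real.pi)))) := by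
  refine LipschitzWith.of_dist_le_mul fun s t => ?_
  refine (hg.dist_le_mul _ _).trans (mul_le_mul_of_nonneg_left ?_ K.2)
  rw [dist_add_left]
  refine (dist_pi_le_iff dist_nonneg).2 fun i => ?_
  rcases eq_or_ne i α with rfl | hi
  · simp only [Pi.single_eq_same]
    rw [dist_eq_norm, dist_eq_norm, ← AddCircle.coe_sub]
    exact QuotientAddGroup.norm_mk_le_norm
  · simp [hi]

lemma norm_pderiv_le {g : Torus d → V} (hg : LipschitzWith K g) (α : Fin d) (x : Torus d) :
    ‖pderiv α g x‖ ≤ K :=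
  norm_deriv_le_of_lipschitz (lipschitzWith_shift hg α x)

lemma measurable_deriv_time [MeasurableSpace V] [BorelSpace V] [CompleteSpace V]
    (hf : Continuous (fun z : Torus d × ℝ => f z.1 z.2)) :
    Measurable (fun z : Torus d × ℝ => deriv (f z.1) z.2) :=
  measurable_deriv_with_param hf

lemma measurable_pderiv [MeasurableSpace V] [BorelSpace V] [CompleteSpace V]
    (hf : Continuous (fun z : Torus d × ℝ => f z.1 z.2)) (α : Fin d) :
    Measurable (fun z : Torus d × ℝ => pderiv α (fun x => f x z.2) z.1) := by
  have hc : Continuous (Function.uncurry fun (z : Torus d × ℝ) (h : ℝ) =>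
      f (z.1 + Pi.single α (h : AddCircle (2 * Real.pi))) z.2) := by
    have hs : Continuous fun w : (Torus d × ℝ) × ℝ =>
        (Pi.single α (w.2 : AddCircle (2 * Real.pi)) : Torus d) :=
      (continuous_single α).comp ((AddCircle.continuous_mk' _).comp continuous_snd)
    exact hf.comp (((continuous_fst.comp continuous_fst).add hs).prodMk
      (continuous_snd.comp continuous_fst))
  have hm : Measurable fun z : Torus d × ℝ => (z, (0 : ℝ)) :=
    measurable_id.prodMk measurable_const
  exact (measurable_deriv_with_param hc).comp hm

/-- Rademacher's theorem along the coordinate lines of `𝕋ᵈ × ℝ`. -/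
lemma ae_differentiableAt_lines [FiniteDimensional ℝ V]
    (hf : LipschitzWith K (fun z : Torus d × ℝ => f z.1 z.2)) :
    ∀ᵐ z : Torus d × ℝ, DifferentiableAt ℝ (f z.1) z.2 ∧
      ∀ α, DifferentiableAt ℝ
        (fun h : ℝ => f (z.1 + Pi.single α (h : AddCircle (2 * Real.pi))) z.2) 0 := by
  refine ae_of_ae_cover ?_
  filter_upwards [(hf.comp Torus.lipschitzWith_cover).ae_differentiableAt] with y hy
  refine ⟨?_, fun α => ?_⟩
  · have h1 : DifferentiableAt ℝ (fun t : ℝ => (y.1, t)) y.2 := by fun_prop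
    exact DifferentiableAt.comp (f := fun t : ℝ => (y.1, t)) y.2 hy h1
  · have h1 : DifferentiableAt ℝ (fun h : ℝ => (y.1 + h • (Pi.single α 1 : Fin d → ℝ), y.2)) 0 := by
      fun_prop
    have h2 := DifferentiableAt.comp (f := fun h : ℝ => (y.1 + h • (Pi.single α 1 : Fin d → ℝ), y.2))
      (0 : ℝ) (by simpa using hy) h1
    simpa [Function.comp_def, Torus.mk_add_single] using h2

/-- Lipschitz functions on `𝕋ᵈ × ℝ` are limits of `C¹` functions, with bounds on the values and
the derivatives and almost everywhere convergence of the derivatives. -/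
lemma exists_contDiff_approx {f : Torus d → ℝ → ℝ} {M : ℝ}
    (hf : LipschitzWith K (fun z : Torus d × ℝ => f z.1 z.2)) (hM : ∀ x t, |f x t| ≤ M) :
    ∃ g : ℕ → Torus d → ℝ → ℝ,
      (∀ k, ContDiff ℝ 1 (fun y : (Fin d → ℝ) × ℝ => g k (Torus.mk y.1) y.2)) ∧
      (∀ k x t, |g k x t| ≤ M) ∧
      (∀ k x t, |deriv (g k x) t| ≤ K) ∧
      (∀ k α x t, |pderiv α (fun y => g k y t) x| ≤ K) ∧
      (∀ x t, Tendsto (fun k => g k x t) atTop (𝓝 (f x t))) ∧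
      (∀ᵐ z : Torus d × ℝ, Tendsto (fun k => deriv (g k z.1) z.2) atTop (𝓝 (deriv (f z.1) z.2))) ∧
      (∀ α, ∀ᵐ z : Torus d × ℝ, Tendsto (fun k => pderiv α (fun y => g k y z.2) z.1) atTop
        (𝓝 (pderiv α (fun y => f y z.2) z.1))) := by
  set F : (Fin d → ℝ) × ℝ → ℝ := fun y => f (Torus.mk y.1) y.2 with hF
  have hFL : LipschitzWith K F := by
    have := hf.comp Torus.lipschitzWith_cover
    rwa [mul_one] at this
  -- `Torus.rep` jumps across the faces of the fundamental cell; periodicity makes the value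
  -- independent of the representative, so the lift of `g k` is the smooth mollification itself.
  have hper : ∀ k (y : Fin d → ℝ) (t : ℝ),
      mollify volume F k (Torus.rep (Torus.mk y), t) = mollify volume F k (y, t) := by
    intro k y t
    obtain ⟨m, hm⟩ := Torus.exists_period y
    have hp : ∀ w : (Fin d → ℝ) × ℝ, F (w + (fun i => (m i : ℝ) * (2 * Real.pi), 0)) = F w := by
      intro w
      simp [hF, Torus.mk_add_period]
    have := mollify_add_period (μ := volume) hp k (Torus.rep (Torus.mk y), t)
    rw [← this, Prod.mk_add_mk, ← hm, add_zero]
  set g : ℕ → Torus d → ℝ → ℝ := fun k x t => mollify volume F k (Torus.rep x, t)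
  have hlift : ∀ k, (fun y : (Fin d → ℝ) × ℝ => g k (Torus.mk y.1) y.2) = mollify volume F k :=
    fun k => funext fun y => hper k y.1 y.2
  have hbound : ∀ (v : (Fin d → ℝ) × ℝ), ‖v‖ ≤ 1 → ∀ k y,
      |lineDeriv ℝ (mollify volume F k) y v| ≤ K := by
    intro v hv k y
    have := norm_lineDeriv_le_of_lipschitz ℝ (lipschitzWith_mollify (μ := volume) hFL k)
      (x₀ := y) (v := v)
    exact this.trans (mul_le_of_le_one_right K.2 hv)
  refine ⟨g, fun k => ?_, fun k x t => ?_, fun k x t => ?_, fun k α x t => ?_, fun x t => ?_, ?_,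
    fun α => ?_⟩
  · rw [hlift]; exact contDiff_mollify hFL.continuous k
  · exact abs_mollify_le (fun y => hM _ _) k _
  · have := lineDeriv_cover_time (g k) (Torus.rep x, t)
    rw [hlift] at this
    simp only [Torus.mk_rep] at this
    rw [← this]
    exact hbound _ (by simp [Prod.norm_def]) k _
  · have := lineDeriv_cover_space (g k) α (Torus.rep x, t)
    rw [hlift] at this
    simp only [Torus.mk_rep] at this
    rw [← this]
    refine hbound _ ?_ k _
    rw [Prod.norm_mk, norm_zero, max_le_iff]
    refine ⟨(pi_norm_le_iff_of_nonneg zero_le_one).2 fun i => ?_, zero_le_one⟩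
    rcases eq_or_ne i α with rfl | hi
    · simp
    · simp [hi]
  · have := tendsto_mollify (μ := volume) hFL.continuous (Torus.rep x, t)
    simpa [hF] using this
  · refine ae_of_ae_cover ?_
    filter_upwards [ae_tendsto_lineDeriv_mollify (μ := volume) hFL (0, 1)] with y hy
    rw [hF, lineDeriv_cover_time f] at hy
    refine hy.congr fun k => ?_
    rw [← lineDeriv_cover_time (g k), hlift]
  · refine ae_of_ae_cover ?_
    filter_upwards [ae_tendsto_lineDeriv_mollify (μ := volume) hFL (Pi.single α 1, 0)] with y hy
    rw [hF, lineDeriv_cover_space f] at hy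
    refine hy.congr fun k => ?_
    rw [← lineDeriv_cover_space (g k), hlift]

end TorusCalculus

/-! ### Integration over space-time cylinders -/

section Cylinder

variable {d : ℕ} {K : ℝ≥0}

lemma volume_restrict_cyl (T : ℝ) :
    (volume : Measure (Torus d × ℝ)).restrict (cyl d T)
      = (volume : Measure (Torus d)).prod (volume.restrict (Ico 0 T)) := by
  rw [cyl, Measure.volume_eq_prod, ← Measure.prod_restrict, Measure.restrict_univ]

instance isFiniteMeasure_restrict_cyl (T : ℝ) :
    IsFiniteMeasure ((volume : Measure (Torus d × ℝ)).restrict (cyl d T)) := by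
  rw [volume_restrict_cyl]
  infer_instance

lemma measurableSet_cyl (T : ℝ) : MeasurableSet (cyl d T) :=
  MeasurableSet.univ.prod measurableSet_Ico

lemma integrable_cyl_of_bound {V : Type*} [NormedAddCommGroup V] {T C : ℝ}
    {f : Torus d × ℝ → V} (hf : AEStronglyMeasurable f (volume.restrict (cyl d T)))
    (hC : ∀ z ∈ cyl d T, ‖f z‖ ≤ C) : Integrable f (volume.restrict (cyl d T)) :=
  Integrable.of_bound hf C ((ae_restrict_iff' (measurableSet_cyl T)).2 (.of_forall hC))

lemma exists_bound_Ico {θ : ℝ → ℝ} (hθ : Continuous θ) (T : ℝ) :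
    ∃ C, 0 ≤ C ∧ ∀ t ∈ Ico 0 T, |θ t| ≤ C := by
  obtain ⟨C, hC⟩ := isCompact_Icc.exists_bound_of_continuousOn (s := Icc 0 T) hθ.continuousOn
  exact ⟨max C 0, le_max_right _ _, fun t ht => (hC t ⟨ht.1, ht.2.le⟩).trans (le_max_left _ _)⟩

/-- The integral over the torus of a partial derivative of a Lipschitz function vanishes. -/
lemma integral_pderiv_eq_zero {g : Torus d → ℝ} (hg : LipschitzWith K g) (α : Fin d) :
    ∫ x, pderiv α g x = 0 := by
  have hdiff : ∀ᵐ x : Torus d, DifferentiableAt ℝ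
      (fun h : ℝ => g (x + Pi.single α (h : AddCircle (2 * Real.pi)))) 0 := by
    have h1 : LipschitzWith K (fun z : Torus d × ℝ => g z.1) := by
      simpa [Function.comp_def] using hg.comp LipschitzWith.prod_fst
    have h2 := ae_differentiableAt_lines (f := fun x _ => g x) h1
    rw [Measure.volume_eq_prod] at h2
    filter_upwards [Measure.ae_ae_of_ae_prod h2] with x hx
    obtain ⟨t, ht⟩ := hx.exists
    exact ht.2 α
  -- The difference quotients are bounded by `K` and converge almost everywhere, while each has
  -- integral zero by translation invariance.
  have hlim : Tendsto (fun h : ℝ => ∫ x,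
      h⁻¹ • (g (x + (Pi.single α ((0 + h : ℝ) : AddCircle (2 * Real.pi)) : Torus d))
        - g (x + (Pi.single α ((0 : ℝ) : AddCircle (2 * Real.pi)) : Torus d)))) (𝓝[≠] 0)
      (𝓝 (∫ x, pderiv α g x)) := by
    refine tendsto_integral_filter_of_dominated_convergence (fun _ => (K : ℝ)) ?_ ?_
      (integrable_const _) ?_
    · refine .of_forall fun h => Continuous.aestronglyMeasurable ?_
      have hc := hg.continuous
      fun_prop
    · filter_upwards [self_mem_nhdsWithin] with h hh
      filter_upwards with x
      have := (lipschitzWith_shift hg α x).dist_le_mul (0 + h) 0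
      rw [dist_eq_norm, dist_zero_right, zero_add] at this
      rw [norm_smul, norm_inv, zero_add, inv_mul_le_iff₀ (norm_pos_iff.2 hh)]
      exact this.trans_eq (mul_comm _ _)
    · filter_upwards [hdiff] with x hx
      exact hasDerivAt_iff_tendsto_slope_zero.1 hx.hasDerivAt
  refine tendsto_nhds_unique hlim ?_
  refine tendsto_const_nhds.congr fun h => ?_
  have hint : Integrable g := by
    obtain ⟨C, hC⟩ := isCompact_univ.exists_bound_of_continuousOn hg.continuous.continuousOn
    exact Integrable.of_bound hg.continuous.aestronglyMeasurable C
      (.of_forall fun x => hC x (mem_univ x))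
  rw [integral_smul, integral_sub (hint.comp_add_right _) (hint.comp_add_right _),
    integral_add_right_eq_self g, integral_add_right_eq_self g, sub_self, smul_zero]

variable {f : Torus d → ℝ → ℝ}

/-- No regularity of `θ` is needed: if the integrand is not integrable, its integral is `0` by
convention; otherwise Fubini reduces to `integral_pderiv_eq_zero`. -/
lemma integral_cyl_mul_pderiv (hf : LipschitzWith K (fun z : Torus d × ℝ => f z.1 z.2))
    (θ : ℝ → ℝ) (T : ℝ) (α : Fin d) :
    ∫ z in cyl d T, θ z.2 * pderiv α (fun y => f y z.2) z.1 = 0 := by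
  by_cases hint : Integrable (fun z : Torus d × ℝ => θ z.2 * pderiv α (fun y => f y z.2) z.1)
    (volume.restrict (cyl d T))
  · rw [volume_restrict_cyl] at hint ⊢
    rw [integral_prod_symm _ hint]
    refine integral_eq_zero_of_ae (.of_forall fun t => ?_)
    simp only [Pi.zero_apply]
    rw [integral_const_mul, integral_pderiv_eq_zero (lipschitzWith_space hf t), mul_zero]
  · exact integral_undef hint

lemma integrable_cyl_deriv_mul (hf : LipschitzWith K (fun z : Torus d × ℝ => f z.1 z.2)) {M : ℝ}
    (hM : ∀ x t, |f x t| ≤ M) {θ : ℝ → ℝ} (hθ : ContDiff ℝ 1 θ) (T : ℝ) :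
    Integrable (fun z : Torus d × ℝ => deriv θ z.2 * f z.1 z.2 + θ z.2 * deriv (f z.1) z.2)
      (volume.restrict (cyl d T)) := by
  obtain ⟨C₀, hC₀, hθ₀⟩ := exists_bound_Ico hθ.continuous T
  obtain ⟨C₁, hC₁, hθ₁⟩ := exists_bound_Ico (hθ.continuous_deriv le_rfl) T
  refine integrable_cyl_of_bound (C := C₁ * M + C₀ * K) ?_ fun z hz => ?_
  · refine Measurable.aestronglyMeasurable ?_
    exact ((((hθ.continuous_deriv le_rfl).comp continuous_snd).mul hf.continuous).measurable).add
      ((hθ.continuous.comp continuous_snd).measurable.mul (measurable_deriv_time hf.continuous))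
  · refine (norm_add_le _ _).trans (add_le_add ?_ ?_)
    · rw [Real.norm_eq_abs, abs_mul]
      exact mul_le_mul (hθ₁ _ hz.2) (hM _ _) (abs_nonneg _) hC₁
    · rw [Real.norm_eq_abs, abs_mul]
      exact mul_le_mul (hθ₀ _ hz.2)
        (norm_deriv_le_of_lipschitz (lipschitzWith_time hf z.1)) (abs_nonneg _) hC₀

lemma integrable_cyl_mul_pderiv (hf : LipschitzWith K (fun z : Torus d × ℝ => f z.1 z.2))
    {θ : ℝ → ℝ} (hθ : Continuous θ) (T : ℝ) (α : Fin d) :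
    Integrable (fun z : Torus d × ℝ => θ z.2 * pderiv α (fun y => f y z.2) z.1)
      (volume.restrict (cyl d T)) := by
  obtain ⟨C₀, hC₀, hθ₀⟩ := exists_bound_Ico hθ T
  refine integrable_cyl_of_bound (C := C₀ * K) ?_ fun z hz => ?_
  · exact ((hθ.comp continuous_snd).measurable.mul
      (measurable_pderiv hf.continuous α)).aestronglyMeasurable
  · rw [Real.norm_eq_abs, abs_mul]
    exact mul_le_mul (hθ₀ _ hz.2) (norm_pderiv_le (lipschitzWith_space hf z.2) α z.1)
      (abs_nonneg _) hC₀

/-- Integration by parts along each time line, valid because `θ` and `f x` are absolutely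
continuous. Only the boundary term at time `0` remains. -/
lemma integral_cyl_deriv_mul (hf : LipschitzWith K (fun z : Torus d × ℝ => f z.1 z.2)) {M : ℝ}
    (hM : ∀ x t, |f x t| ≤ M) {θ : ℝ → ℝ} (hθ : ContDiff ℝ 1 θ) {T : ℝ} (hT : 0 ≤ T)
    (hθT : θ T = 0) :
    ∫ z in cyl d T, (deriv θ z.2 * f z.1 z.2 + θ z.2 * deriv (f z.1) z.2)
      = -(θ 0 * ∫ x, f x 0) := by
  have hint := integrable_cyl_deriv_mul hf hM hθ T
  rw [volume_restrict_cyl] at hint ⊢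
  rw [integral_prod _ hint, ← integral_const_mul, ← integral_neg]
  refine integral_congr_ae (.of_forall fun x => ?_)
  simp only
  have hθac : AbsolutelyContinuousOnInterval θ 0 T :=
    hθ.contDiffOn.absolutelyContinuousOnInterval
  have hfac : AbsolutelyContinuousOnInterval (f x) 0 T :=
    ((lipschitzWith_time hf x).lipschitzOnWith).absolutelyContinuousOnInterval
  have h := hθac.integral_deriv_mul_eq_sub hfac
  rw [hθT, zero_mul, zero_sub] at h
  rw [← h, intervalIntegral.integral_of_le hT, integral_Ico_eq_integral_Ioc]

end Cylinder

/-! ### Pointwise estimates for the relative entropy -/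

section Pointwise

set_option linter.unusedSectionVars false

variable {E F : Type*} [NormedAddCommGroup E] [NormedSpace ℝ E] [FiniteDimensional ℝ E]
  [NormedAddCommGroup F] [NormedSpace ℝ F]

lemma exists_norm_le_on_ball {h : E → F} (hh : Continuous h) (R : ℝ) :
    ∃ C, 0 ≤ C ∧ ∀ v, ‖v‖ ≤ R → ‖h v‖ ≤ C := by
  have := FiniteDimensional.proper ℝ E
  obtain ⟨C, hC⟩ := (isCompact_closedBall (0 : E) R).exists_bound_of_continuousOn hh.continuousOn
  exact ⟨max C 0, le_max_right _ _, fun v hv =>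
    (hC v (mem_closedBall_zero_iff.2 hv)).trans (le_max_left _ _)⟩

lemma exists_lipschitz_on_ball {h : E → F} (hh : ContDiff ℝ 1 h) (R : ℝ) :
    ∃ L, 0 ≤ L ∧ ∀ u v, ‖u‖ ≤ R → ‖v‖ ≤ R → ‖h u - h v‖ ≤ L * ‖u - v‖ := by
  obtain ⟨C, hC0, hC⟩ := exists_norm_le_on_ball (hh.continuous_fderiv one_ne_zero) R
  refine ⟨C, hC0, fun u v hu hv => ?_⟩
  exact (convex_closedBall (0 : E) R).norm_image_sub_le_of_norm_fderiv_le (𝕜 := ℝ)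
    (fun x _ => hh.differentiable one_ne_zero x)
    (fun x hx => hC x (mem_closedBall_zero_iff.1 hx)) (mem_closedBall_zero_iff.2 hv)
    (mem_closedBall_zero_iff.2 hu)

/-- The mean value inequality for `h` minus its linearization at `v`: along the segment the
derivative differs from `fderiv ℝ h v` by at most `L‖u - v‖`. -/
lemma exists_taylor_on_ball {h : E → F} (hh : ContDiff ℝ 2 h) (R : ℝ) :
    ∃ L, 0 ≤ L ∧ ∀ u v, ‖u‖ ≤ R → ‖v‖ ≤ R →
      ‖h u - h v - fderiv ℝ h v (u - v)‖ ≤ L * ‖u - v‖ ^ 2 := by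
  obtain ⟨L, hL0, hL⟩ := exists_lipschitz_on_ball
    (hh.fderiv_right (m := 1) (by norm_num)) R
  refine ⟨L, hL0, fun u v hu hv => ?_⟩
  have hseg : segment ℝ v u ⊆ Metric.closedBall 0 R :=
    (convex_closedBall (0 : E) R).segment_subset (mem_closedBall_zero_iff.2 hv)
      (mem_closedBall_zero_iff.2 hu)
  have := Convex.norm_image_sub_le_of_norm_hasFDerivWithin_le' (𝕜 := ℝ) (f := h)
    (f' := fderiv ℝ h) (φ := fderiv ℝ h v) (C := L * ‖u - v‖)
    (fun x _ => (hh.differentiable two_ne_zero x).hasFDerivAt.hasFDerivWithinAt)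
    (fun x hx => ?_) (convex_segment v u) (left_mem_segment ℝ v u) (right_mem_segment ℝ v u)
  · rwa [mul_assoc, ← sq] at this
  · refine (hL x v (mem_closedBall_zero_iff.1 (hseg hx)) hv).trans ?_
    refine mul_le_mul_of_nonneg_left ?_ hL0
    exact norm_sub_le_of_mem_segment hx

lemma exists_growth_bound {h : E → F} {H : E → ℝ} (hh : Continuous h) (hH : ∀ v, 0 ≤ H v)
    (ho : h =o[Bornology.cobounded E] H) : ∃ C, 0 ≤ C ∧ ∀ u, ‖h u‖ ≤ C * (1 + H u) := by
  have h1 := ho.def one_pos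
  obtain ⟨R, -, hR⟩ := (Metric.hasBasis_cobounded_compl_closedBall (0 : E)).eventually_iff.1 h1
  obtain ⟨C, hC0, hC⟩ := exists_norm_le_on_ball hh R
  refine ⟨max C 1, by positivity, fun u => ?_⟩
  have hu := hH u
  by_cases hR' : ‖u‖ ≤ R
  · calc ‖h u‖ ≤ C := hC u hR'
      _ ≤ max C 1 * 1 := by rw [mul_one]; exact le_max_left _ _
      _ ≤ _ := by gcongr; linarith
  · have h2 := hR (x := u) (by simpa using hR')
    rw [Real.norm_of_nonneg hu, one_mul] at h2
    calc ‖h u‖ ≤ H u := h2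
      _ ≤ 1 * (1 + H u) := by linarith
      _ ≤ _ := by gcongr; exact le_max_right _ _

/-- The Hessian of a function with prescribed `C¹` gradient is symmetric. -/
lemma fderiv_grad_symm {φ : E → ℝ} {φ' : E → E →L[ℝ] ℝ} (h : ∀ v, HasFDerivAt φ (φ' v) v)
    (h' : ∀ ζ, ContDiff ℝ 1 (fun v => φ' v ζ)) (v ξ ζ : E) :
    fderiv ℝ (fun w => φ' w ζ) v ξ = fderiv ℝ (fun w => φ' w ξ) v ζ := by
  have hd : DifferentiableAt ℝ φ' v :=
    (contDiff_clm_apply_iff.2 h').differentiable one_ne_zero v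
  have key : ∀ ξ ζ, fderiv ℝ (fun w => φ' w ζ) v ξ = fderiv ℝ φ' v ξ ζ := by
    intro ξ ζ
    rw [fderiv_clm_apply hd (differentiableAt_const ζ)]
    simp
  rw [key, key]
  exact second_derivative_symmetric h hd.hasFDerivAt ξ ζ

end Pointwise

/-- An entropy structure written in conserved variables: `g` is the gradient of the strictly
convex entropy `H`. -/
structure ConservedStructure {n d : ℕ} (f : Fin d → State n → State n) (H : State n → ℝ)
    (q : Fin d → State n → ℝ) (g : State n → State n) : Prop where
  contDiff_f : ∀ α, ContDiff ℝ 2 (f α)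
  contDiff_g : ContDiff ℝ 2 g
  grad_H : ∀ v, HasFDerivAt H (innerSL ℝ (g v)) v
  grad_q : ∀ α v, HasFDerivAt (q α) ((innerSL ℝ (g v)).comp (fderiv ℝ (f α) v)) v
  pos_def : ∀ v ξ, ξ ≠ 0 → 0 < (inner ℝ (fderiv ℝ g v ξ) ξ : ℝ)
  nonneg : ∀ v, 0 ≤ H v
  growth_id : (fun v => v) =o[Bornology.cobounded (State n)] H
  growth_f : ∀ α, f α =o[Bornology.cobounded (State n)] H
  growth_g : g =o[Bornology.cobounded (State n)] H

/-- The relative entropy `H(u | v)`. -/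
noncomputable def relEntropy {n : ℕ} (H : State n → ℝ) (g : State n → State n) (u v : State n) :
    ℝ :=
  H u - H v - inner ℝ (g v) (u - v)

/-! ### Convexity and growth estimates for the relative entropy. -/

namespace ConservedStructure

variable {n d : ℕ} {f : Fin d → State n → State n} {H : State n → ℝ}
  {q : Fin d → State n → ℝ} {g : State n → State n}

section

variable (hs : ConservedStructure f H q g)
include hs

lemma continuous_H : Continuous H :=
  continuous_iff_continuousAt.2 fun v => (hs.grad_H v).continuousAt

lemma differentiable_g : Differentiable ℝ g := hs.contDiff_g.differentiable two_ne_zero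

lemma hessian_symm (v ξ ζ : State n) :
    (inner ℝ (fderiv ℝ g v ξ) ζ : ℝ) = inner ℝ (fderiv ℝ g v ζ) ξ := by
  have h := fderiv_grad_symm hs.grad_H (fun ζ => by
    simp only [innerSL_apply_apply]
    exact (hs.contDiff_g.of_le one_le_two).inner ℝ contDiff_const) v ξ ζ
  simp only [innerSL_apply_apply] at h
  rw [fderiv_inner_apply ℝ (hs.differentiable_g v) (differentiableAt_const ζ),
    fderiv_inner_apply ℝ (hs.differentiable_g v) (differentiableAt_const ξ)] at h
  simpa using h

/-- The Hessian of `q α` is `Dg ξ · Df_α ζ + g · D²f_α(ξ, ζ)`. It is symmetric and so is its second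
term, hence so is the first. -/
lemma flux_symm (α : Fin d) (v ξ ζ : State n) :
    (inner ℝ (fderiv ℝ g v ξ) (fderiv ℝ (f α) v ζ) : ℝ)
      = inner ℝ (fderiv ℝ g v ζ) (fderiv ℝ (f α) v ξ) := by
  have hf1 : ContDiff ℝ 1 (fderiv ℝ (f α)) := (hs.contDiff_f α).fderiv_right (by norm_num)
  have hf2 : ∀ ζ, ContDiff ℝ 1 (fun v => fderiv ℝ (f α) v ζ) := fun ζ =>
    hf1.clm_apply contDiff_const
  have h := fderiv_grad_symm (hs.grad_q α) (fun ζ => by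
    simp only [ContinuousLinearMap.comp_apply, innerSL_apply_apply]
    exact (hs.contDiff_g.of_le one_le_two).inner ℝ (hf2 ζ)) v ξ ζ
  simp only [ContinuousLinearMap.comp_apply, innerSL_apply_apply] at h
  rw [fderiv_inner_apply ℝ (hs.differentiable_g v) ((hf2 ζ).differentiable one_ne_zero v),
    fderiv_inner_apply ℝ (hs.differentiable_g v) ((hf2 ξ).differentiable one_ne_zero v)] at h
  have hsymm : IsSymmSndFDerivAt ℝ (f α) v :=
    (hs.contDiff_f α).contDiffAt.isSymmSndFDerivAt (by simp)
  have key : ∀ ξ ζ, fderiv ℝ (fun w => fderiv ℝ (f α) w ζ) v ξ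
      = fderiv ℝ (fderiv ℝ (f α)) v ξ ζ := by
    intro ξ ζ
    rw [fderiv_clm_apply (hf1.differentiable one_ne_zero v) (differentiableAt_const ζ)]
    simp
  rw [key, key, hsymm.eq ξ ζ] at h
  linarith

/-- Minimum over the compact set of points of the ball and unit directions, then homogeneity of
degree two in `ξ`. -/
lemma exists_pos_hessian (R : ℝ) :
    ∃ c, 0 < c ∧ ∀ v, ‖v‖ ≤ R → ∀ ξ, c * ‖ξ‖ ^ 2 ≤ inner ℝ (fderiv ℝ g v ξ) ξ := by
  have hcont : Continuous fun p : State n × State n => (inner ℝ (fderiv ℝ g p.1 p.2) p.2 : ℝ) :=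
    (((hs.contDiff_g.continuous_fderiv two_ne_zero).comp continuous_fst).clm_apply
      continuous_snd).inner continuous_snd
  have hcpt := (isCompact_closedBall (0 : State n) R).prod (isCompact_sphere (0 : State n) 1)
  have key : ∃ c, 0 < c ∧ ∀ p ∈ Metric.closedBall (0 : State n) R ×ˢ Metric.sphere (0 : State n) 1,
      c ≤ (inner ℝ (fderiv ℝ g p.1 p.2) p.2 : ℝ) := by
    -- The product is empty when `R < 0`, or when `n = 0` and there is no unit vector; any positive
    -- constant then serves.
    rcases (Metric.closedBall (0 : State n) R ×ˢ Metric.sphere (0 : State n) 1).eq_empty_or_nonempty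
      with he | hne
    · exact ⟨1, one_pos, by simp [he]⟩
    · obtain ⟨p, hp, hmin⟩ := hcpt.exists_isMinOn hne hcont.continuousOn
      refine ⟨_, hs.pos_def p.1 p.2 ?_, fun p' hp' => hmin hp'⟩
      have : ‖p.2‖ = 1 := mem_sphere_zero_iff_norm.1 hp.2
      intro h0
      simp [h0] at this
  obtain ⟨c, hc, hmin⟩ := key
  refine ⟨c, hc, fun v hv ξ => ?_⟩
  rcases eq_or_ne ξ 0 with rfl | hξ
  · simp
  · have hξ' : ‖ξ‖ ≠ 0 := norm_ne_zero_iff.2 hξ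
    have := hmin (v, ‖ξ‖⁻¹ • ξ) ⟨mem_closedBall_zero_iff.2 hv, by
      simp [norm_smul, hξ']⟩
    simp only [map_smul, real_inner_smul_left, real_inner_smul_right] at this
    calc c * ‖ξ‖ ^ 2
        ≤ (‖ξ‖⁻¹ * (‖ξ‖⁻¹ * inner ℝ (fderiv ℝ g v ξ) ξ)) * ‖ξ‖ ^ 2 := by gcongr
      _ = inner ℝ (fderiv ℝ g v ξ) ξ := by field_simp

/-- On bounded sets the relative entropy controls the square of the distance. -/
lemma exists_relEntropy_ge (R : ℝ) :
    ∃ c, 0 < c ∧ ∀ u v, ‖u‖ ≤ R → ‖v‖ ≤ R → c * ‖u - v‖ ^ 2 ≤ relEntropy H g u v := by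
  obtain ⟨c, hc, hpos⟩ := hs.exists_pos_hessian R
  refine ⟨c / 2, by positivity, fun u v hu hv => ?_⟩
  set ξ := u - v with hξ
  have hball : ∀ s ∈ Icc (0 : ℝ) 1, ‖v + s • ξ‖ ≤ R := by
    intro s hs'
    have := (convex_closedBall (0 : State n) R).add_smul_sub_mem (mem_closedBall_zero_iff.2 hv)
      (mem_closedBall_zero_iff.2 hu) hs'
    exact mem_closedBall_zero_iff.1 this
  have hline : ∀ s : ℝ, HasDerivAt (fun s : ℝ => v + s • ξ) ξ s := fun s => by
    simpa using ((hasDerivAt_id s).smul_const ξ).const_add v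
  -- Taylor's formula in the form of two monotonicity arguments on the segment from `v` to `u`:
  -- first for the slope `g(v + sξ)·ξ - c‖ξ‖²s`, then for `H` minus its tangent and the parabola
  -- `c/2 ‖ξ‖² s²`.
  have hg1 : ∀ s : ℝ, HasDerivAt (fun s : ℝ => (inner ℝ (g (v + s • ξ)) ξ : ℝ) - c * ‖ξ‖ ^ 2 * s)
      (inner ℝ (fderiv ℝ g (v + s • ξ) ξ) ξ - c * ‖ξ‖ ^ 2) s := by
    intro s
    have h1 := ((hs.differentiable_g (v + s • ξ)).hasFDerivAt.comp_hasDerivAt s (hline s)).inner ℝ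
      (hasDerivAt_const s ξ)
    have h2 := h1.sub ((hasDerivAt_id s).const_mul (c * ‖ξ‖ ^ 2))
    refine h2.congr_deriv ?_
    simp
  have hmono1 : MonotoneOn (fun s : ℝ => (inner ℝ (g (v + s • ξ)) ξ : ℝ) - c * ‖ξ‖ ^ 2 * s)
      (Icc 0 1) := by
    refine monotoneOn_of_deriv_nonneg (convex_Icc 0 1)
      (fun s _ => (hg1 s).continuousAt.continuousWithinAt)
      (fun s _ => (hg1 s).differentiableAt.differentiableWithinAt) fun s hs' => ?_
    rw [(hg1 s).deriv]
    exact sub_nonneg.2 (hpos _ (hball s (interior_subset hs')) ξ)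
  have hH1 : ∀ s : ℝ, HasDerivAt
      (fun s : ℝ => H (v + s • ξ) - s * inner ℝ (g v) ξ - c / 2 * ‖ξ‖ ^ 2 * s ^ 2)
      (inner ℝ (g (v + s • ξ)) ξ - inner ℝ (g v) ξ - c * ‖ξ‖ ^ 2 * s) s := by
    intro s
    have h1 := (hs.grad_H (v + s • ξ)).comp_hasDerivAt s (hline s)
    have h2 := (h1.sub ((hasDerivAt_id s).mul_const (inner ℝ (g v) ξ : ℝ))).sub
      ((hasDerivAt_pow 2 s).const_mul (c / 2 * ‖ξ‖ ^ 2))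
    refine h2.congr_deriv ?_
    simp only [innerSL_apply_apply, one_mul, Nat.cast_ofNat]
    ring
  have hmono2 : MonotoneOn
      (fun s : ℝ => H (v + s • ξ) - s * inner ℝ (g v) ξ - c / 2 * ‖ξ‖ ^ 2 * s ^ 2) (Icc 0 1) := by
    refine monotoneOn_of_deriv_nonneg (convex_Icc 0 1)
      (fun s _ => (hH1 s).continuousAt.continuousWithinAt)
      (fun s _ => (hH1 s).differentiableAt.differentiableWithinAt) fun s hs' => ?_
    rw [(hH1 s).deriv]
    have hs2 : s ∈ Icc (0 : ℝ) 1 := interior_subset hs'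
    have := hmono1 (left_mem_Icc.2 zero_le_one) hs2 hs2.1
    simp only [zero_smul, add_zero, mul_zero, sub_zero] at this
    linarith
  have := hmono2 (left_mem_Icc.2 zero_le_one) (right_mem_Icc.2 zero_le_one) zero_le_one
  simp only [zero_smul, add_zero, one_smul, zero_mul, sub_zero, one_mul, one_pow, mul_one,
    zero_pow two_ne_zero, mul_zero] at this
  have huv : v + ξ = u := by rw [hξ]; abel
  rw [huv] at this
  rw [relEntropy]
  linarith

lemma relEntropy_nonneg (u v : State n) : 0 ≤ relEntropy H g u v := by
  obtain ⟨c, hc, h⟩ := hs.exists_relEntropy_ge (max ‖u‖ ‖v‖)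
  exact le_trans (by positivity) (h u v (le_max_left _ _) (le_max_right _ _))

lemma eq_of_relEntropy_eq_zero {u v : State n} (h0 : relEntropy H g u v = 0) : u = v := by
  obtain ⟨c, hc, h⟩ := hs.exists_relEntropy_ge (max ‖u‖ ‖v‖)
  have h1 := h u v (le_max_left _ _) (le_max_right _ _)
  rw [h0] at h1
  have h2 : ‖u - v‖ ^ 2 ≤ 0 := by
    by_contra hcon
    push Not at hcon
    nlinarith
  have h3 : ‖u - v‖ = 0 := by
    have := sq_nonneg ‖u - v‖
    exact pow_eq_zero_iff two_ne_zero |>.1 (le_antisymm h2 this)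
  exact sub_eq_zero.1 (norm_eq_zero.1 h3)

/-- Far away from a bounded set the relative entropy controls the entropy. -/
lemma exists_relEntropy_ge_of_large (M : ℝ) :
    ∃ R, M ≤ R ∧ ∀ u v, ‖v‖ ≤ M → R < ‖u‖ → 1 / 8 * (1 + H u) ≤ relEntropy H g u v := by
  obtain ⟨C₁, hC₁, h₁⟩ := exists_norm_le_on_ball (h := fun v => H v - inner ℝ (g v) v)
    (hs.continuous_H.sub (hs.contDiff_g.continuous.inner continuous_id)) M
  obtain ⟨C₂, hC₂, h₂⟩ := exists_norm_le_on_ball hs.contDiff_g.continuous M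
  -- With this constant the linear term `g(v)·u` absorbs at most half of `H u`. The second bound
  -- gives `‖u‖ ≤ H u`, so `‖u‖ > 4C₁ + 1` makes `H u / 2 - C₁` at least `(1 + H u)/8`.
  have e1 := hs.growth_id.def (c := 1 / (2 * (C₂ + 1))) (by positivity)
  have e2 := hs.growth_id.def one_pos
  obtain ⟨R, -, hR⟩ := (Metric.hasBasis_cobounded_compl_closedBall
    (0 : State n)).eventually_iff.1 (e1.and e2)
  refine ⟨max (max R M) (4 * C₁ + 1), (le_max_right _ _).trans (le_max_left _ _),
    fun u v hv hu => ?_⟩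
  have hu1 : R < ‖u‖ := lt_of_le_of_lt ((le_max_left _ _).trans (le_max_left _ _)) hu
  have hu2 : 4 * C₁ + 1 < ‖u‖ := lt_of_le_of_lt (le_max_right _ _) hu
  obtain ⟨k1, k2⟩ := hR (x := u) (by simpa using hu1)
  rw [Real.norm_of_nonneg (hs.nonneg u)] at k1 k2
  have k3 : (inner ℝ (g v) u : ℝ) ≤ H u / 2 := by
    calc (inner ℝ (g v) u : ℝ) ≤ ‖g v‖ * ‖u‖ := real_inner_le_norm _ _
      _ ≤ (C₂ + 1) * (1 / (2 * (C₂ + 1)) * H u) := by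
          gcongr
          linarith [h₂ v hv]
      _ = H u / 2 := by field_simp
  have k4 := (Real.le_norm_self _).trans (h₁ v hv)
  rw [relEntropy, inner_sub_right]
  linarith

/-- A quantity which is locally quadratic in `u - v` and globally dominated by `1 + H u` is
dominated by the relative entropy. -/
lemma exists_le_relEntropy {M : ℝ} {s : State n → State n → ℝ}
    (hloc : ∀ R, ∃ L, 0 ≤ L ∧ ∀ u v, ‖u‖ ≤ R → ‖v‖ ≤ R → s u v ≤ L * ‖u - v‖ ^ 2)
    (hglob : ∃ C, 0 ≤ C ∧ ∀ u v, ‖v‖ ≤ M → s u v ≤ C * (1 + H u)) :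
    ∃ C, 0 ≤ C ∧ ∀ u v, ‖v‖ ≤ M → s u v ≤ C * relEntropy H g u v := by
  obtain ⟨R, hMR, hR⟩ := hs.exists_relEntropy_ge_of_large M
  obtain ⟨c, hc, hcR⟩ := hs.exists_relEntropy_ge R
  obtain ⟨L, hL, hloc⟩ := hloc R
  obtain ⟨C, hC, hglob⟩ := hglob
  -- `L / c` handles `‖u‖ ≤ R` by quadratic comparison; `8 * C` handles large `u`, `8` being the
  -- inverse of the factor in `exists_relEntropy_ge_of_large`.
  refine ⟨L / c + 8 * C, by positivity, fun u v hv => ?_⟩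
  have h0 := hs.relEntropy_nonneg u v
  by_cases hu : ‖u‖ ≤ R
  · calc s u v ≤ L * ‖u - v‖ ^ 2 := hloc u v hu (hv.trans hMR)
      _ = L / c * (c * ‖u - v‖ ^ 2) := by field_simp
      _ ≤ L / c * relEntropy H g u v := by
          gcongr
          exact hcR u v hu (hv.trans hMR)
      _ ≤ _ := by nlinarith
  · push Not at hu
    calc s u v ≤ C * (1 + H u) := hglob u v hv
      _ = 8 * C * (1 / 8 * (1 + H u)) := by ring
      _ ≤ 8 * C * relEntropy H g u v := by
          gcongr
          exact hR u v hv hu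
      _ ≤ _ := by
          have : 0 ≤ L / c * relEntropy H g u v := by positivity
          linarith

/-- The remainder is quadratic near `v` and, since `h` and the identity are `o(H)`, of size `1 + H
u` globally. It is applied to `f α` and to `g`. -/
lemma exists_norm_taylor_le_relEntropy {h : State n → State n} (hh : ContDiff ℝ 2 h)
    (ho : h =o[Bornology.cobounded (State n)] H) (M : ℝ) :
    ∃ C, 0 ≤ C ∧ ∀ u v, ‖v‖ ≤ M →
      ‖h u - h v - fderiv ℝ h v (u - v)‖ ≤ C * relEntropy H g u v := by
  refine hs.exists_le_relEntropy (s := fun u v => ‖h u - h v - fderiv ℝ h v (u - v)‖)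
    (fun R => exists_taylor_on_ball hh R) ?_
  obtain ⟨C₁, hC₁, h₁⟩ := exists_growth_bound hh.continuous hs.nonneg ho
  obtain ⟨C₂, hC₂, h₂⟩ := exists_growth_bound continuous_id hs.nonneg hs.growth_id
  obtain ⟨C₃, hC₃, h₃⟩ := exists_norm_le_on_ball hh.continuous M
  obtain ⟨C₄, hC₄, h₄⟩ := exists_norm_le_on_ball (hh.continuous_fderiv two_ne_zero) M
  refine ⟨C₁ + C₃ + C₄ * (C₂ + |M|), by positivity, fun u v hv => ?_⟩
  have hH := hs.nonneg u
  have k1 : ‖u - v‖ ≤ (C₂ + |M|) * (1 + H u) := by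
    refine (norm_sub_le _ _).trans ?_
    have := h₂ u
    have h5 : ‖v‖ ≤ |M| := hv.trans (le_abs_self M)
    have h6 := abs_nonneg M
    simp only [id] at this
    nlinarith
  calc ‖h u - h v - fderiv ℝ h v (u - v)‖
      ≤ ‖h u‖ + ‖h v‖ + ‖fderiv ℝ h v‖ * ‖u - v‖ := by
        refine (norm_sub_le _ _).trans (add_le_add (norm_sub_le _ _) ?_)
        exact ContinuousLinearMap.le_opNorm _ _
    _ ≤ C₁ * (1 + H u) + C₃ * (1 + H u) + C₄ * ((C₂ + |M|) * (1 + H u)) := by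
        have := h₃ v hv
        gcongr
        · exact h₁ u
        · nlinarith
        · exact h₄ v hv
    _ = _ := by ring

/-- The relative production is dominated by the relative entropy. -/
lemma exists_production_le_relEntropy {P : State n → State n} (hP : ContDiff ℝ 1 P)
    (hGP : WeaklyDissipative g P ∨ GrowthP g P H) (M : ℝ) :
    ∃ C, 0 ≤ C ∧ ∀ u v, ‖v‖ ≤ M →
      (inner ℝ (g u - g v) (P u) : ℝ) - inner ℝ (P v) (fderiv ℝ g v (u - v))
        ≤ C * relEntropy H g u v := by
  obtain ⟨C₁, hC₁, h₁⟩ := hs.exists_norm_taylor_le_relEntropy hs.contDiff_g hs.growth_g M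
  obtain ⟨C₂, hC₂, h₂⟩ := exists_norm_le_on_ball hP.continuous M
  -- Weak dissipation makes this product nonpositive, so `C = 0`. In the other case both factors are
  -- locally Lipschitz, which gives the quadratic bound, and the growth of `P`, `g` and `g·P` gives
  -- the global one.
  have key : ∃ C, 0 ≤ C ∧ ∀ u v, ‖v‖ ≤ M →
      (inner ℝ (g u - g v) (P u - P v) : ℝ) ≤ C * relEntropy H g u v := by
    rcases hGP with hd | ⟨hgp, hp⟩
    · refine ⟨0, le_rfl, fun u v _ => ?_⟩
      rw [zero_mul]
      exact hd u v
    · refine hs.exists_le_relEntropy (s := fun u v => inner ℝ (g u - g v) (P u - P v))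
        (fun R => ?_) ?_
      · obtain ⟨L₁, hL₁, k₁⟩ := exists_lipschitz_on_ball (hs.contDiff_g.of_le one_le_two) R
        obtain ⟨L₂, hL₂, k₂⟩ := exists_lipschitz_on_ball hP R
        refine ⟨L₁ * L₂, by positivity, fun u v hu hv => ?_⟩
        calc (inner ℝ (g u - g v) (P u - P v) : ℝ) ≤ ‖g u - g v‖ * ‖P u - P v‖ :=
              real_inner_le_norm _ _
          _ ≤ (L₁ * ‖u - v‖) * (L₂ * ‖u - v‖) := by
              gcongr
              · exact k₁ u v hu hv
              · exact k₂ u v hu hv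
          _ = _ := by ring
      · obtain ⟨D₁, hD₁, k₁⟩ := exists_growth_bound
          (hs.contDiff_g.continuous.inner (𝕜 := ℝ) hP.continuous) hs.nonneg hgp
        obtain ⟨D₂, hD₂, k₂⟩ := exists_growth_bound hP.continuous hs.nonneg hp
        obtain ⟨D₃, hD₃, k₃⟩ := exists_growth_bound hs.contDiff_g.continuous hs.nonneg hs.growth_g
        obtain ⟨D₄, hD₄, k₄⟩ := exists_norm_le_on_ball hs.contDiff_g.continuous M
        refine ⟨D₁ + D₃ * C₂ + D₄ * D₂ + D₄ * C₂, by positivity, fun u v hv => ?_⟩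
        have hH := hs.nonneg u
        have j1 : (inner ℝ (g u) (P u) : ℝ) ≤ D₁ * (1 + H u) :=
          (Real.le_norm_self _).trans (k₁ u)
        have j2 : -(inner ℝ (g u) (P v) : ℝ) ≤ D₃ * (1 + H u) * C₂ := by
          refine (neg_le_abs _).trans ((abs_real_inner_le_norm _ _).trans ?_)
          exact mul_le_mul (k₃ u) (h₂ v hv) (norm_nonneg _) (by positivity)
        have j3 : -(inner ℝ (g v) (P u) : ℝ) ≤ D₄ * (D₂ * (1 + H u)) := by
          refine (neg_le_abs _).trans ((abs_real_inner_le_norm _ _).trans ?_)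
          exact mul_le_mul (k₄ v hv) (k₂ u) (norm_nonneg _) (by positivity)
        have j4 : (inner ℝ (g v) (P v) : ℝ) ≤ D₄ * C₂ := by
          refine (real_inner_le_norm _ _).trans ?_
          exact mul_le_mul (k₄ v hv) (h₂ v hv) (norm_nonneg _) (by positivity)
        have j5 : 0 ≤ D₄ * C₂ * H u := by positivity
        simp only [inner_sub_left, inner_sub_right]
        nlinarith
  obtain ⟨C₃, hC₃, h₃⟩ := key
  refine ⟨C₃ + C₂ * C₁, by positivity, fun u v hv => ?_⟩
  -- Inserting `P v` separates the product of differences from the Taylor remainder of `g`, which is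
  -- paired with the bounded vector `P v`.
  have hid : (inner ℝ (g u - g v) (P u) : ℝ) - inner ℝ (P v) (fderiv ℝ g v (u - v))
      = inner ℝ (g u - g v) (P u - P v)
        + inner ℝ (P v) (g u - g v - fderiv ℝ g v (u - v)) := by
    rw [inner_sub_right (g u - g v), inner_sub_right (P v),
      real_inner_comm (g u - g v) (P v)]
    ring
  have k1 : (inner ℝ (P v) (g u - g v - fderiv ℝ g v (u - v)) : ℝ)
      ≤ C₂ * (C₁ * relEntropy H g u v) := by
    refine (real_inner_le_norm _ _).trans ?_
    exact mul_le_mul (h₂ v hv) (h₁ u v hv) (norm_nonneg _) hC₂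
  rw [hid]
  linarith [h₃ u v hv]

end

end ConservedStructure

/-! ### Conserved variables -/

section ConservedVariables

variable {n d : ℕ} {p : ℝ} {A : State n → State n} {F : Fin d → State n → State n}
  {η : State n → ℝ} {q : Fin d → State n → ℝ} {G : State n → State n}

/-- The lower bound of `η` in terms of `‖u‖ ^ p` and its upper bound in terms of `‖A u‖ ^ r` force
`‖A u‖ → ∞`. This is what makes `A` proper. -/
lemma GrowthConditions.tendsto_A_cobounded (hg : GrowthConditions p A F η) (hp : 0 < p) :
    Tendsto A (Bornology.cobounded (State n)) (Bornology.cobounded (State n)) := by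
  obtain ⟨β₁, β₂, B, hβ₁, -, -, hη⟩ := hg.growth_η
  obtain ⟨r, C, B', hr, hC, -, hA⟩ := hg.growth_H
  have h1 : Tendsto (fun u : State n => (β₁ * (‖u‖ ^ p + 1) - B) / C - 1)
      (Bornology.cobounded (State n)) atTop := by
    have h2 := (tendsto_rpow_atTop hp).comp (tendsto_norm_cobounded_atTop (E := State n))
    have h3 := tendsto_atTop_add_const_right _ (1 : ℝ) h2
    have h4 := tendsto_atTop_add_const_right _ (-B) (h3.const_mul_atTop hβ₁)
    exact tendsto_atTop_add_const_right _ (-1 : ℝ) (h4.atTop_div_const hC)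
  have h2 : Tendsto (fun u => ‖A u‖ ^ r) (Bornology.cobounded (State n)) atTop := by
    refine tendsto_atTop_mono (fun u => ?_) h1
    have := (hη u).1.trans (hA u).2
    rw [sub_le_iff_le_add, div_le_iff₀ hC]
    linarith
  rw [← tendsto_norm_atTop_iff_cobounded]
  refine tendsto_atTop.2 fun b => ?_
  filter_upwards [h2.eventually_gt_atTop (|b| ^ r)] with u hu
  by_contra hlt
  push Not at hlt
  exact absurd (Real.rpow_le_rpow (norm_nonneg _) (hlt.le.trans (le_abs_self b)) (by linarith))
    (not_le.2 hu)

/-- Under the growth conditions `A` is a `C²` diffeomorphism of `ℝⁿ` onto itself. -/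
lemma exists_homeomorph_A (hs : EntropyStructure A F η q G) (hg : GrowthConditions p A F η)
    (hp : 0 < p) : ∃ e : State n ≃ₜ State n, (⇑e = A) ∧ ContDiff ℝ 2 e.symm := by
  set A' : State n → State n ≃L[ℝ] State n := fun u =>
    (fderiv ℝ A u).toContinuousLinearEquivOfDetNeZero (hs.nonsingular u)
  have hA' : ∀ u, HasStrictFDerivAt A (A' u : State n →L[ℝ] State n) u := by
    intro u
    have := hs.contDiff_A.contDiffAt.hasStrictFDerivAt (x := u) two_ne_zero
    rwa [← ContinuousLinearMap.coe_toContinuousLinearEquivOfDetNeZero _ (hs.nonsingular u)] at this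
  have hopen : IsOpenMap A := isOpenMap_of_hasStrictFDerivAt_equiv hA'
  have hproper : IsProperMap A := by
    refine isProperMap_iff_tendsto_cocompact.2 ⟨hs.contDiff_A.continuous, ?_⟩
    simpa only [Metric.cobounded_eq_cocompact] using hg.tendsto_A_cobounded hp
  -- The range is open by the inverse function theorem and closed by properness, hence everything,
  -- by connectedness.
  have hsurj : Function.Surjective A := by
    have hclopen : IsClopen (range A) := ⟨hproper.isClosedMap.isClosed_range, hopen.isOpen_range⟩
    exact range_eq_univ.1 (hclopen.eq_univ (range_nonempty A))
  let e : State n ≃ₜ State n := (Equiv.ofBijective A ⟨hs.injective_A, hsurj⟩)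
    |>.toHomeomorphOfContinuousOpen hs.contDiff_A.continuous hopen
  have he : ⇑e = A := rfl
  refine ⟨e, he, e.contDiff_symm (f₀' := A') (fun u => ?_) ?_⟩
  · rw [he]; exact (hA' u).hasFDerivAt
  · rw [he]; exact hs.contDiff_A

/-- The Hessian of the entropy in the direction of the multiplier. -/
lemma EntropyStructure.inner_fderiv_G_pos (hs : EntropyStructure A F η q G) (u ξ : State n)
    (hξ : ξ ≠ 0) : 0 < (inner ℝ (fderiv ℝ G u ξ) (fderiv ℝ A u ξ) : ℝ) := by
  have hη1 : ContDiff ℝ 1 (fderiv ℝ η) := hs.contDiff_η.fderiv_right (by norm_num)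
  have hA1 : ContDiff ℝ 1 (fderiv ℝ A) := hs.contDiff_A.fderiv_right (by norm_num)
  have h1 : fderiv ℝ (fun w => fderiv ℝ η w ξ) u ξ = fderiv ℝ (fderiv ℝ η) u ξ ξ := by
    rw [fderiv_clm_apply (hη1.differentiable one_ne_zero u) (differentiableAt_const ξ)]
    simp
  have h2 : fderiv ℝ (fun w => fderiv ℝ A w ξ) u ξ = fderiv ℝ (fderiv ℝ A) u ξ ξ := by
    rw [fderiv_clm_apply (hA1.differentiable one_ne_zero u) (differentiableAt_const ξ)]
    simp
  -- Differentiating `∇η ξ = G·(∇A ξ)` in the direction `ξ` gives `∇²η(ξ,ξ) = (∇G ξ)·(∇A ξ) +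
  -- G·∇²A(ξ,ξ)`, so `pos_def` is the claim.
  simp_rw [hs.grad_η] at h1
  rw [fderiv_inner_apply ℝ (hs.contDiff_G.differentiable two_ne_zero u)
    ((hA1.clm_apply contDiff_const).differentiable one_ne_zero u), h2] at h1
  have := hs.pos_def u ξ hξ
  linarith

/-- Chain rule with `∇A ∘ ∇A⁻¹ = id`: the gradient of `η ∘ A⁻¹` is `G·∇A·∇A⁻¹ = G`, and
`inner_fderiv_G_pos` at the direction `∇A⁻¹ ξ` gives convexity. The growth of `A` becomes that of
the identity, and `A⁻¹` tends to infinity at infinity, so the little-o conditions are transported.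
-/
lemma EntropyStructure.conserved (hs : EntropyStructure A F η q G)
    (hg : GrowthConditions p A F η) (hη : ∀ u, 0 ≤ η u) (hG : GrowthG G η)
    {e : State n ≃ₜ State n} (he : ⇑e = A) (he2 : ContDiff ℝ 2 e.symm) :
    ConservedStructure (fun α => F α ∘ e.symm) (η ∘ e.symm) (fun α => q α ∘ e.symm)
      (G ∘ e.symm) := by
  have hAe : ∀ v, A (e.symm v) = v := fun v => by rw [← he]; exact e.apply_symm_apply v
  have hde : ∀ v, HasFDerivAt e.symm (fderiv ℝ e.symm v) v := fun v =>
    (he2.differentiable two_ne_zero v).hasFDerivAt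
  have hinv : ∀ v ξ, fderiv ℝ A (e.symm v) (fderiv ℝ e.symm v ξ) = ξ := by
    intro v ξ
    have h1 := ((hs.contDiff_A.differentiable two_ne_zero (e.symm v)).hasFDerivAt.comp v (hde v))
    have h2 : A ∘ e.symm = id := funext hAe
    rw [h2] at h1
    have := DFunLike.congr_fun (h1.unique (hasFDerivAt_id v)) ξ
    simpa using this
  have htend : Tendsto e.symm (Bornology.cobounded (State n)) (Bornology.cobounded (State n)) := by
    rw [Metric.cobounded_eq_cocompact]
    exact e.symm.isClosedEmbedding.tendsto_cocompact
  refine ⟨fun α => (hs.contDiff_F α).comp he2, hs.contDiff_G.comp he2, fun v => ?_,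
    fun α v => ?_, fun v ξ hξ => ?_, fun v => hη _, ?_, fun α => (hg.growth_F α).comp_tendsto htend,
    hG.comp_tendsto htend⟩
  · have h1 := (hs.contDiff_η.differentiable two_ne_zero (e.symm v)).hasFDerivAt.comp v (hde v)
    refine h1.congr_fderiv ?_
    ext ξ
    simp [hs.grad_η, hinv]
  · have h1 := (hs.differentiable_q α (e.symm v)).hasFDerivAt.comp v (hde v)
    have h2 := ((hs.contDiff_F α).differentiable two_ne_zero (e.symm v)).hasFDerivAt.comp v (hde v)
    refine h1.congr_fderiv ?_
    ext ξ
    rw [h2.fderiv]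
    simp [hs.grad_q]
  · have h1 := (hs.contDiff_G.differentiable two_ne_zero (e.symm v)).hasFDerivAt.comp v (hde v)
    rw [h1.fderiv]
    have hne : fderiv ℝ e.symm v ξ ≠ 0 := by
      intro h0
      have := hinv v ξ
      rw [h0, map_zero] at this
      exact hξ this.symm
    have := hs.inner_fderiv_G_pos (e.symm v) _ hne
    rwa [hinv] at this
  · have := hg.growth_A.comp_tendsto htend
    simpa [Function.comp_def, hAe] using this

end ConservedVariables

/-! ### Lipschitz test functions -/

section LipschitzTest

variable {n d : ℕ} {T T' C : ℝ}

lemma cyl_subset_cyl (h : T' ≤ T) : cyl d T' ⊆ cyl d T :=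
  prod_mono le_rfl (Ico_subset_Ico_right h)

lemma le_of_mem_cyl_diff {z : Torus d × ℝ} (hz : z ∈ cyl d T \ cyl d T') : T' ≤ z.2 := by
  by_contra hlt
  exact hz.2 ⟨mem_univ _, hz.1.2.1, not_le.1 hlt⟩

section

variable {V : Type*} [NormedAddCommGroup V] [NormedSpace ℝ V] {a : Torus d × ℝ → V}

/-- The pairings are integrable only up to times `T' < T`; a weight vanishing from `T'` on restores
integrability on the full cylinder. -/
lemma integrable_cyl_smul (ha : Integrable a (volume.restrict (cyl d T')))
    {w : Torus d × ℝ → ℝ} (hw : Measurable w) (hC : ∀ z ∈ cyl d T', |w z| ≤ C)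
    (h0 : ∀ z, T' ≤ z.2 → w z = 0) :
    Integrable (fun z => w z • a z) (volume.restrict (cyl d T)) := by
  have h1 : IntegrableOn (fun z => w z • a z) (cyl d T') :=
    ha.bdd_smul C hw.aestronglyMeasurable
      ((ae_restrict_iff' (measurableSet_cyl T')).2 (.of_forall hC))
  refine IntegrableOn.of_forall_sdiff_eq_zero h1 (measurableSet_cyl T) fun z hz => ?_
  rw [h0 z (le_of_mem_cyl_diff hz), zero_smul]

lemma setIntegral_cyl_eq (hT : T' ≤ T) {w : Torus d × ℝ → ℝ} (h0 : ∀ z, T' ≤ z.2 → w z = 0) :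
    ∫ z in cyl d T, w z • a z = ∫ z in cyl d T', w z • a z := by
  refine setIntegral_eq_of_subset_of_forall_sdiff_eq_zero (measurableSet_cyl T)
    (cyl_subset_cyl hT) fun z hz => ?_
  rw [h0 z (le_of_mem_cyl_diff hz), zero_smul]

lemma tendsto_setIntegral_cyl_smul (hT : T' ≤ T)
    (ha : Integrable a (volume.restrict (cyl d T')))
    {w : ℕ → Torus d × ℝ → ℝ} {w' : Torus d × ℝ → ℝ} (hw : ∀ k, Measurable (w k))
    (hC : ∀ k, ∀ z ∈ cyl d T', |w k z| ≤ C) (h0 : ∀ k z, T' ≤ z.2 → w k z = 0)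
    (h0' : ∀ z, T' ≤ z.2 → w' z = 0)
    (hlim : ∀ᵐ z, Tendsto (fun k => w k z) atTop (𝓝 (w' z))) :
    Tendsto (fun k => ∫ z in cyl d T, w k z • a z) atTop (𝓝 (∫ z in cyl d T, w' z • a z)) := by
  simp_rw [setIntegral_cyl_eq hT h0', fun k => setIntegral_cyl_eq (a := a) hT (h0 k)]
  refine tendsto_integral_of_dominated_convergence (fun z => C * ‖a z‖)
    (fun k => (hw k).aestronglyMeasurable.smul ha.aestronglyMeasurable) (ha.norm.const_mul C)
    (fun k => ?_) ?_
  · refine (ae_restrict_iff' (measurableSet_cyl T')).2 (.of_forall fun z hz => ?_)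
    rw [norm_smul]
    exact mul_le_mul_of_nonneg_right (hC k z hz) (norm_nonneg _)
  · filter_upwards [ae_restrict_of_ae hlim] with z hz
    exact hz.smul_const _

end

lemma deriv_eq_zero_of_support {θ : ℝ → ℝ} {T₁ t : ℝ} (h : ∀ t ≥ T₁, θ t = 0) (ht : T₁ < t) :
    deriv θ t = 0 := by
  have : θ =ᶠ[𝓝 t] fun _ => 0 := by
    filter_upwards [lt_mem_nhds ht] with s hs using h s hs.le
  rw [this.deriv_eq, deriv_const]

variable {a c : Torus d × ℝ → State n} {b : Fin d → Torus d × ℝ → State n}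
  {a₀ : Torus d → State n} {θ : ℝ → ℝ}

/-- Weak formulation of a system of balance laws `∂_t a + ∂_α b_α = c` on `𝕋ᵈ × [0, T)` with
initial value `a₀`, with locally integrable entries. -/
structure IsWeakBalance (T : ℝ) (a : Torus d × ℝ → State n) (b : Fin d → Torus d × ℝ → State n)
    (c : Torus d × ℝ → State n) (a₀ : Torus d → State n) : Prop where
  integrable_a : ∀ T' < T, Integrable a (volume.restrict (cyl d T'))
  integrable_b : ∀ T' < T, ∀ α, Integrable (b α) (volume.restrict (cyl d T'))
  integrable_c : ∀ T' < T, Integrable c (volume.restrict (cyl d T'))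
  integrable_a₀ : Integrable a₀
  equation : ∀ φ : Torus d → ℝ → ℝ, IsTest T φ →
    (∫ z in cyl d T, deriv (φ z.1) z.2 • a z)
      + (∫ z in cyl d T, ∑ α, pderiv α (fun y => φ y z.2) z.1 • b α z)
      + (∫ z in cyl d T, φ z.1 z.2 • c z)
      + (∫ x, φ x 0 • a₀ x) = 0

/-- The weak formulation may be tested with the product of a `C¹` function of time and a Lipschitz
function. -/
lemma IsWeakBalance.lipschitz_test (h : IsWeakBalance T a b c a₀) (hθ : ContDiff ℝ 1 θ)
    (hsupp : ∃ T₁ < T, ∀ t ≥ T₁, θ t = 0) {Γ : Torus d → ℝ → ℝ} {K : ℝ≥0} {M : ℝ}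
    (hΓ : LipschitzWith K (fun z : Torus d × ℝ => Γ z.1 z.2)) (hM : ∀ x t, |Γ x t| ≤ M) :
    Integrable (fun z : Torus d × ℝ =>
      (deriv θ z.2 * Γ z.1 z.2 + θ z.2 * deriv (Γ z.1) z.2) • a z
        + ∑ α, (θ z.2 * pderiv α (fun y => Γ y z.2) z.1) • b α z
        + (θ z.2 * Γ z.1 z.2) • c z) (volume.restrict (cyl d T)) ∧
    (∫ z in cyl d T, ((deriv θ z.2 * Γ z.1 z.2 + θ z.2 * deriv (Γ z.1) z.2) • a z
        + ∑ α, (θ z.2 * pderiv α (fun y => Γ y z.2) z.1) • b α z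
        + (θ z.2 * Γ z.1 z.2) • c z)) + ∫ x, (θ 0 * Γ x 0) • a₀ x = 0 := by
  obtain ⟨T₁, hT₁, hsupp⟩ := hsupp
  -- Strictly beyond `T₁` the derivative of `θ` vanishes too, and strictly before `T` the entries
  -- are integrable.
  obtain ⟨T', hT', hT⟩ := exists_between hT₁
  have hM0 : 0 ≤ M := (abs_nonneg _).trans (hM 0 0)
  have hθ' := hθ.continuous_deriv le_rfl
  obtain ⟨C₀, hC₀, hθ₀⟩ := exists_bound_Ico hθ.continuous T'
  obtain ⟨C₁, hC₁, hθ₁⟩ := exists_bound_Ico hθ' T'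
  have z0 : ∀ t, T' ≤ t → θ t = 0 := fun t ht => hsupp t (hT'.le.trans ht)
  have z1 : ∀ t, T' ≤ t → deriv θ t = 0 := fun t ht =>
    deriv_eq_zero_of_support hsupp (hT'.trans_le ht)
  have mθ : Measurable fun z : Torus d × ℝ => θ z.2 :=
    (hθ.continuous.comp continuous_snd).measurable
  have mθ' : Measurable fun z : Torus d × ℝ => deriv θ z.2 :=
    (hθ'.comp continuous_snd).measurable
  -- bounds and measurability for the weights built from a general function
  have hbt : ∀ {u v : Torus d × ℝ → ℝ}, (∀ z, |u z| ≤ M) → (∀ z, |v z| ≤ K) →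
      ∀ z ∈ cyl d T', |deriv θ z.2 * u z + θ z.2 * v z| ≤ C₁ * M + C₀ * K := by
    intro u v hu hv z hz
    refine (abs_add_le _ _).trans (add_le_add ?_ ?_)
    · rw [abs_mul]; exact mul_le_mul (hθ₁ _ hz.2) (hu z) (abs_nonneg _) hC₁
    · rw [abs_mul]; exact mul_le_mul (hθ₀ _ hz.2) (hv z) (abs_nonneg _) hC₀
  have hb : ∀ {v : Torus d × ℝ → ℝ} {B : ℝ}, (∀ z, |v z| ≤ B) →
      ∀ z ∈ cyl d T', |θ z.2 * v z| ≤ C₀ * B := by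
    intro v B hv z hz
    rw [abs_mul]; exact mul_le_mul (hθ₀ _ hz.2) (hv z) (abs_nonneg _) hC₀
  have bΓt : ∀ z : Torus d × ℝ, |deriv (Γ z.1) z.2| ≤ K := fun z =>
    norm_deriv_le_of_lipschitz (lipschitzWith_time hΓ z.1)
  have bΓs : ∀ α, ∀ z : Torus d × ℝ, |pderiv α (fun y => Γ y z.2) z.1| ≤ K := fun α z =>
    norm_pderiv_le (lipschitzWith_space hΓ z.2) α z.1
  have mΓ : Measurable fun z : Torus d × ℝ => Γ z.1 z.2 := hΓ.continuous.measurable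
  have mΓt := measurable_deriv_time hΓ.continuous
  have mΓs := measurable_pderiv hΓ.continuous
  have iA := integrable_cyl_smul (T := T) (h.integrable_a T' hT)
    (w := fun z => deriv θ z.2 * Γ z.1 z.2 + θ z.2 * deriv (Γ z.1) z.2) ((mθ'.mul mΓ).add (mθ.mul mΓt))
    (hbt (fun z => hM z.1 z.2) bΓt) (fun z hz => by simp [z0 z.2 hz, z1 z.2 hz])
  have iB := fun α => integrable_cyl_smul (T := T) (h.integrable_b T' hT α)
    (w := fun z => θ z.2 * pderiv α (fun y => Γ y z.2) z.1) (mθ.mul (mΓs α))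
    (hb (bΓs α)) (fun z hz => by simp [z0 z.2 hz])
  have iC := integrable_cyl_smul (T := T) (h.integrable_c T' hT)
    (w := fun z => θ z.2 * Γ z.1 z.2) (mθ.mul mΓ)
    (hb (fun z => hM z.1 z.2)) (fun z hz => by simp [z0 z.2 hz])
  have iB' := integrable_finsetSum (Finset.univ : Finset (Fin d)) fun α _ => iB α
  refine ⟨(iA.add iB').add iC, ?_⟩
  -- The derivatives of the approximations converge only almost everywhere, but with uniform bounds;
  -- dominated convergence against the integrable `a`, `b α`, `c` needs no more.
  obtain ⟨g, g1, g2, g3, g4, g5, g6, g7⟩ := exists_contDiff_approx hΓ hM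
  have gcont : ∀ k, Continuous fun z : Torus d × ℝ => g k z.1 z.2 := by
    intro k
    have hq : IsOpenQuotientMap (fun y : (Fin d → ℝ) × ℝ => ((Torus.mk y.1 : Torus d), y.2)) := by
      have h1 : IsOpenQuotientMap (Torus.mk : (Fin d → ℝ) → Torus d) :=
        IsOpenQuotientMap.piMap fun _ => QuotientAddGroup.isOpenQuotientMap_mk
      exact h1.prodMap IsOpenQuotientMap.id
    exact hq.isQuotientMap.continuous_iff.2 (g1 k).continuous
  have gdiff : ∀ k x, Differentiable ℝ (g k x) := by
    intro k x
    have h1 : Differentiable ℝ fun t : ℝ => ((Torus.rep x, t) : (Fin d → ℝ) × ℝ) := by fun_prop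
    have h2 := ((g1 k).differentiable one_ne_zero).comp h1
    simpa [Function.comp_def] using h2
  have htest : ∀ k, IsTest T (fun x t => θ t * g k x t) := fun k =>
    ⟨(hθ.comp contDiff_snd).mul (g1 k), T₁, hT₁, fun x t ht => by simp [hsupp t ht]⟩
  have hdt : ∀ k (z : Torus d × ℝ), deriv (fun t => θ t * g k z.1 t) z.2
      = deriv θ z.2 * g k z.1 z.2 + θ z.2 * deriv (g k z.1) z.2 := fun k z =>
    deriv_fun_mul (hθ.differentiable one_ne_zero _) (gdiff k z.1 z.2)
  have hds : ∀ k α (z : Torus d × ℝ), pderiv α (fun y => θ z.2 * g k y z.2) z.1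
      = θ z.2 * pderiv α (fun y => g k y z.2) z.1 := fun k α z =>
    deriv_const_mul_field _
  have heq := fun k => h.equation _ (htest k)
  simp only [hdt, hds] at heq
  have l1 := tendsto_setIntegral_cyl_smul (a := a) hT.le (h.integrable_a T' hT)
    (w := fun k z => deriv θ z.2 * g k z.1 z.2 + θ z.2 * deriv (g k z.1) z.2)
    (w' := fun z => deriv θ z.2 * Γ z.1 z.2 + θ z.2 * deriv (Γ z.1) z.2)
    (fun k => (mθ'.mul (gcont k).measurable).add (mθ.mul (measurable_deriv_time (gcont k))))
    (fun k => hbt (fun z => g2 k z.1 z.2) (fun z => g3 k z.1 z.2))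
    (fun k z hz => by simp [z0 z.2 hz, z1 z.2 hz]) (fun z hz => by simp [z0 z.2 hz, z1 z.2 hz])
    (by filter_upwards [g6] with z hz using ((g5 z.1 z.2).const_mul _).add (hz.const_mul _))
  have l2 := fun α => tendsto_setIntegral_cyl_smul (a := b α) hT.le (h.integrable_b T' hT α)
    (w := fun k z => θ z.2 * pderiv α (fun y => g k y z.2) z.1)
    (w' := fun z => θ z.2 * pderiv α (fun y => Γ y z.2) z.1)
    (fun k => mθ.mul (measurable_pderiv (gcont k) α))
    (fun k => hb (fun z => g4 k α z.1 z.2))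
    (fun k z hz => by simp [z0 z.2 hz]) (fun z hz => by simp [z0 z.2 hz])
    (by filter_upwards [g7 α] with z hz using hz.const_mul _)
  have l3 := tendsto_setIntegral_cyl_smul (a := c) hT.le (h.integrable_c T' hT)
    (w := fun k z => θ z.2 * g k z.1 z.2) (w' := fun z => θ z.2 * Γ z.1 z.2)
    (fun k => mθ.mul (gcont k).measurable) (fun k => hb (fun z => g2 k z.1 z.2))
    (fun k z hz => by simp [z0 z.2 hz]) (fun z hz => by simp [z0 z.2 hz])
    (.of_forall fun z => (g5 z.1 z.2).const_mul _)
  have l4 : Tendsto (fun k => ∫ x, (θ 0 * g k x 0) • a₀ x) atTop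
      (𝓝 (∫ x, (θ 0 * Γ x 0) • a₀ x)) := by
    refine tendsto_integral_of_dominated_convergence (fun x => |θ 0| * M * ‖a₀ x‖)
      (fun k => ?_) (h.integrable_a₀.norm.const_mul _) (fun k => .of_forall fun x => ?_)
      (.of_forall fun x => ((g5 x 0).const_mul _).smul_const _)
    · have hm : Continuous fun x => θ 0 * g k x 0 :=
        continuous_const.mul ((gcont k).comp (continuous_id.prodMk continuous_const))
      exact hm.aestronglyMeasurable.smul h.integrable_a₀.aestronglyMeasurable
    · rw [norm_smul, norm_mul]
      gcongr
      · exact le_rfl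
      · exact g2 k x 0
  have isum : ∀ k, ∫ z in cyl d T, ∑ α, (θ z.2 * pderiv α (fun y => g k y z.2) z.1) • b α z
      = ∑ α, ∫ z in cyl d T, (θ z.2 * pderiv α (fun y => g k y z.2) z.1) • b α z := fun k =>
    integral_finsetSum _ fun α _ => integrable_cyl_smul (T := T) (h.integrable_b T' hT α)
      (mθ.mul (measurable_pderiv (gcont k) α)) (hb (fun z => g4 k α z.1 z.2))
      (fun z hz => by simp [z0 z.2 hz])
  simp only [isum] at heq
  have ltot := ((l1.add (tendsto_finsetSum Finset.univ fun α _ => l2 α)).add l3).add l4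
  simp only [heq] at ltot
  have hfin := tendsto_nhds_unique ltot tendsto_const_nhds
  have s1 := integral_add (iA.add iB') iC
  have s2 := integral_add iA iB'
  simp only [Pi.add_apply] at s1
  rw [s1, s2, integral_finsetSum _ fun α _ => iB α]
  exact hfin

/-- The weak formulation tested with a vector valued Lipschitz function. -/
lemma IsWeakBalance.lipschitz_test_inner (h : IsWeakBalance T a b c a₀) (hθ : ContDiff ℝ 1 θ)
    (hsupp : ∃ T₁ < T, ∀ t ≥ T₁, θ t = 0) {Γ : Torus d → ℝ → State n} {K : ℝ≥0} {M : ℝ}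
    (hΓ : LipschitzWith K (fun z : Torus d × ℝ => Γ z.1 z.2)) (hM : ∀ x t, ‖Γ x t‖ ≤ M) :
    Integrable (fun z : Torus d × ℝ =>
      deriv θ z.2 * inner ℝ (Γ z.1 z.2) (a z)
        + θ z.2 * (inner ℝ (deriv (Γ z.1) z.2) (a z)
          + ∑ α, inner ℝ (pderiv α (fun y => Γ y z.2) z.1) (b α z)
          + inner ℝ (Γ z.1 z.2) (c z))) (volume.restrict (cyl d T)) ∧
    (∫ z in cyl d T, (deriv θ z.2 * inner ℝ (Γ z.1 z.2) (a z)
        + θ z.2 * (inner ℝ (deriv (Γ z.1) z.2) (a z)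
          + ∑ α, inner ℝ (pderiv α (fun y => Γ y z.2) z.1) (b α z)
          + inner ℝ (Γ z.1 z.2) (c z)))) + θ 0 * ∫ x, inner ℝ (Γ x 0) (a₀ x) = 0 := by
  have hproj : ∀ i, LipschitzWith K (fun z : Torus d × ℝ => Γ z.1 z.2 i) := fun i =>
    LipschitzWith.of_dist_le_mul fun z w => by
      refine le_trans ?_ (hΓ.dist_le_mul z w)
      rw [dist_eq_norm, dist_eq_norm]
      exact PiLp.norm_apply_le (Γ z.1 z.2 - Γ w.1 w.2) i
  have hMi : ∀ i x t, |Γ x t i| ≤ M := fun i x t => (PiLp.norm_apply_le (Γ x t) i).trans (hM x t)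
  have key := fun i => h.lipschitz_test hθ hsupp (Γ := fun x t => Γ x t i) (hproj i) (hMi i)
  -- The scalar test function `θ Γᵢ` yields a vector identity, of which only the `i`-th component is
  -- kept; summing over `i` produces the inner products.
  set J : Fin n → Torus d × ℝ → State n := fun i z =>
    (deriv θ z.2 * Γ z.1 z.2 i + θ z.2 * deriv (fun t => Γ z.1 t i) z.2) • a z
        + ∑ α, (θ z.2 * pderiv α (fun y => Γ y z.2 i) z.1) • b α z
        + (θ z.2 * Γ z.1 z.2 i) • c z with hJ
  have hJi : ∀ i, Integrable (fun z => J i z i) (volume.restrict (cyl d T)) := fun i =>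
    (EuclideanSpace.proj i : State n →L[ℝ] ℝ).integrable_comp (key i).1
  have hJint : ∀ i, ∫ z in cyl d T, J i z i = (∫ z in cyl d T, J i z) i := fun i =>
    (EuclideanSpace.proj i : State n →L[ℝ] ℝ).integral_comp_comm (key i).1
  have hΓ0 : ∀ i, Integrable (fun x => (θ 0 * Γ x 0 i) • a₀ x) := fun i => by
    have hm : Continuous fun x => θ 0 * Γ x 0 i :=
      continuous_const.mul ((hproj i).continuous.comp (continuous_id.prodMk continuous_const))
    refine h.integrable_a₀.bdd_smul (|θ 0| * M) hm.aestronglyMeasurable (.of_forall fun x => ?_)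
    rw [norm_mul]
    exact mul_le_mul_of_nonneg_left (hMi i x 0) (abs_nonneg _)
  have h0i : ∀ i, Integrable (fun x => ((θ 0 * Γ x 0 i) • a₀ x) i) := fun i =>
    (EuclideanSpace.proj i : State n →L[ℝ] ℝ).integrable_comp (hΓ0 i)
  have h0int : ∀ i, ∫ x, ((θ 0 * Γ x 0 i) • a₀ x) i = (∫ x, (θ 0 * Γ x 0 i) • a₀ x) i := fun i =>
    (EuclideanSpace.proj i : State n →L[ℝ] ℝ).integral_comp_comm (hΓ0 i)
  -- The derivative of a component equals the component of the derivative where `Γ` is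
  -- differentiable along the coordinate lines, hence almost everywhere.
  have hae : (fun z => ∑ i, J i z i) =ᵐ[volume.restrict (cyl d T)] fun z : Torus d × ℝ =>
      deriv θ z.2 * inner ℝ (Γ z.1 z.2) (a z)
        + θ z.2 * (inner ℝ (deriv (Γ z.1) z.2) (a z)
          + ∑ α, inner ℝ (pderiv α (fun y => Γ y z.2) z.1) (b α z)
          + inner ℝ (Γ z.1 z.2) (c z)) := by
    filter_upwards [ae_restrict_of_ae (ae_differentiableAt_lines hΓ)] with z hz
    have d1 : ∀ i, deriv (fun t => Γ z.1 t i) z.2 = deriv (Γ z.1) z.2 i := fun i =>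
      ((EuclideanSpace.proj i : State n →L[ℝ] ℝ).hasFDerivAt.comp_hasDerivAt z.2
        hz.1.hasDerivAt).deriv
    have d2 : ∀ i α, pderiv α (fun y => Γ y z.2 i) z.1 = pderiv α (fun y => Γ y z.2) z.1 i :=
      fun i α => ((EuclideanSpace.proj i : State n →L[ℝ] ℝ).hasFDerivAt.comp_hasDerivAt (0 : ℝ)
        (hz.2 α).hasDerivAt).deriv
    simp only [hJ, d1, d2, PiLp.inner_apply, PiLp.add_apply, PiLp.smul_apply, smul_eq_mul,
      WithLp.ofLp_sum, Finset.sum_apply, RCLike.inner_apply, conj_trivial,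
      Finset.sum_add_distrib, Finset.mul_sum, mul_add, add_mul]
    rw [Finset.sum_comm]
    simp only [mul_comm, mul_left_comm]
    ring
  have hsum := integrable_finsetSum (Finset.univ : Finset (Fin n)) fun i _ => hJi i
  refine ⟨hsum.congr hae, ?_⟩
  rw [← integral_congr_ae hae, integral_finsetSum _ fun i _ => hJi i]
  have h0 : θ 0 * ∫ x, (inner ℝ (Γ x 0) (a₀ x) : ℝ)
      = ∑ i, ∫ x, ((θ 0 * Γ x 0 i) • a₀ x) i := by
    rw [← integral_finsetSum _ fun i _ => h0i i, ← integral_const_mul]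
    refine integral_congr_ae (.of_forall fun x => ?_)
    simp only [PiLp.inner_apply, RCLike.inner_apply, conj_trivial, PiLp.smul_apply, smul_eq_mul,
      Finset.mul_sum]
    exact Finset.sum_congr rfl fun i _ => by ring
  rw [h0, ← Finset.sum_add_distrib]
  refine Finset.sum_eq_zero fun i _ => ?_
  rw [hJint, h0int, ← PiLp.add_apply, (key i).2, PiLp.zero_apply]

end LipschitzTest

/-! ### The averaged relative entropy inequality -/

lemma pderiv_comp {d : ℕ} {V W : Type*} [NormedAddCommGroup V] [NormedSpace ℝ V]
    [NormedAddCommGroup W] [NormedSpace ℝ W] {h : V → W} {v : Torus d → V} {x : Torus d}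
    {α : Fin d} (hh : DifferentiableAt ℝ h (v x))
    (hv : DifferentiableAt ℝ
      (fun s : ℝ => v (x + Pi.single α (s : AddCircle (2 * Real.pi)))) 0) :
    pderiv α (fun y => h (v y)) x = fderiv ℝ h (v x) (pderiv α v x) :=
  (hh.hasFDerivAt.comp_hasDerivAt_of_eq (0 : ℝ) hv.hasDerivAt (by simp)).deriv

lemma integrable_relEntropy {n : ℕ} {H : State n → ℝ} {g : State n → State n}
    {m : Measure (State n)} [IsProbabilityMeasure m] (v : State n)
    (h1 : Integrable (fun w => w) m) (h2 : Integrable H m) :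
    Integrable (fun w => relEntropy H g w v) m :=
  (h2.sub (integrable_const _)).sub ((h1.sub (integrable_const _)).const_inner _)

/-- The relative entropy is affine in `H w` and `w`, so its average involves only two moments of the
measure, plus the term `g(v)·v - H(v)`. -/
lemma integral_relEntropy {n : ℕ} {H : State n → ℝ} {g : State n → State n}
    {m : Measure (State n)} [IsProbabilityMeasure m] (v : State n)
    (h1 : Integrable (fun w => w) m) (h2 : Integrable H m) :
    ∫ w, relEntropy H g w v ∂m
      = (∫ w, H w ∂m) - inner ℝ (g v) (∫ w, w ∂m) + (inner ℝ (g v) v - H v) := by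
  have h3 : Integrable (fun w => w - v) m := h1.sub (integrable_const _)
  simp only [relEntropy]
  have h4 := integral_sub (h2.sub (integrable_const (H v))) (h3.const_inner (𝕜 := ℝ) (g v))
  simp only [Pi.sub_apply] at h4
  rw [h4, integral_sub h2 (integrable_const _), integral_inner h3, integral_sub h1 (integrable_const _)]
  simp [inner_sub_right]
  ring

namespace ConservedStructure

variable {n d : ℕ} {f : Fin d → State n → State n} {H : State n → ℝ}
  {q : Fin d → State n → ℝ} {g P : State n → State n}

section

variable (hs : ConservedStructure f H q g)
include hs

/-- This function is the Legendre dual of `H` read at `g(v)`. The two terms `g(v)·ξ` cancel, leaving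
only the derivative of `g`. -/
lemma hasFDerivAt_dual (v : State n) :
    HasFDerivAt (fun v => (inner ℝ (g v) v : ℝ) - H v)
      ((innerSL ℝ v).comp (fderiv ℝ g v)) v := by
  refine (((hs.differentiable_g v).hasFDerivAt.inner ℝ (hasFDerivAt_id v)).sub
    (hs.grad_H v)).congr_fderiv ?_
  ext ξ
  simp [fderivInnerCLM_apply, real_inner_comm]

lemma hasFDerivAt_dualFlux (α : Fin d) (v : State n) :
    HasFDerivAt (fun v => (inner ℝ (g v) (f α v) : ℝ) - q α v)
      ((innerSL ℝ (f α v)).comp (fderiv ℝ g v)) v := by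
  refine (((hs.differentiable_g v).hasFDerivAt.inner ℝ
    ((hs.contDiff_f α).differentiable two_ne_zero v).hasFDerivAt).sub
    (hs.grad_q α v)).congr_fderiv ?_
  ext ξ
  simp [fderivInnerCLM_apply, real_inner_comm]

lemma contDiff_dual : ContDiff ℝ 1 (fun v => (inner ℝ (g v) v : ℝ) - H v) := by
  have hd : Differentiable ℝ (fun v => (inner ℝ (g v) v : ℝ) - H v) := fun v =>
    (hs.hasFDerivAt_dual v).differentiableAt
  refine contDiff_one_iff_fderiv.2 ⟨hd, ?_⟩
  refine continuous_clm_apply.2 fun ξ => ?_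
  simp_rw [fun v => (hs.hasFDerivAt_dual v).fderiv, ContinuousLinearMap.comp_apply,
    innerSL_apply_apply]
  exact continuous_id.inner
    ((hs.contDiff_g.continuous_fderiv two_ne_zero).clm_apply continuous_const)

/-- `q α` is only assumed differentiable; continuity of the derivative is read off from the formula
in `hasFDerivAt_dualFlux`. -/
lemma contDiff_dualFlux (α : Fin d) :
    ContDiff ℝ 1 (fun v => (inner ℝ (g v) (f α v) : ℝ) - q α v) := by
  have hd : Differentiable ℝ (fun v => (inner ℝ (g v) (f α v) : ℝ) - q α v) := fun v =>
    (hs.hasFDerivAt_dualFlux α v).differentiableAt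
  refine contDiff_one_iff_fderiv.2 ⟨hd, ?_⟩
  refine continuous_clm_apply.2 fun ξ => ?_
  simp_rw [fun v => (hs.hasFDerivAt_dualFlux α v).fderiv, ContinuousLinearMap.comp_apply,
    innerSL_apply_apply]
  exact (hs.contDiff_f α).continuous.inner
    ((hs.contDiff_g.continuous_fderiv two_ne_zero).clm_apply continuous_const)

/-- The right-hand side of the relative entropy identity is dominated by the relative entropy. -/
lemma exists_relative_rhs_le (hP : ContDiff ℝ 1 P)
    (hGP : WeaklyDissipative g P ∨ GrowthP g P H) (M B : ℝ) :
    ∃ C, 0 ≤ C ∧ ∀ (v τ : State n) (σ : Fin d → State n), ‖v‖ ≤ M →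
      (∀ α, ‖fderiv ℝ g v (σ α)‖ ≤ B) → τ + ∑ α, fderiv ℝ (f α) v (σ α) = P v →
      ∀ w, (inner ℝ (g w) (P w) : ℝ) - inner ℝ (fderiv ℝ g v τ) (w - v)
          - ∑ α, inner ℝ (fderiv ℝ g v (σ α)) (f α w - f α v) - inner ℝ (g v) (P w)
        ≤ C * relEntropy H g w v := by
  obtain ⟨C₁, hC₁, h₁⟩ := hs.exists_production_le_relEntropy hP hGP M
  choose C₂ hC₂ h₂ using fun α =>
    hs.exists_norm_taylor_le_relEntropy (hs.contDiff_f α) (hs.growth_f α) M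
  refine ⟨C₁ + ∑ α, |B| * C₂ α,
    add_nonneg hC₁ (Finset.sum_nonneg fun α _ => mul_nonneg (abs_nonneg _) (hC₂ α)),
    fun v τ σ hv hσ heq w => ?_⟩
  -- Here `τ` and `σ α` play the roles of `∂_t v` and `∂_α v`.
  have hτ : τ = P v - ∑ α, fderiv ℝ (f α) v (σ α) := eq_sub_of_add_eq heq
  -- Symmetry of `Dg` moves it onto `w - v`; the equation then replaces `τ`, and `flux_symm` turns
  -- the flux terms into the linear part of `f α w - f α v`, leaving only Taylor remainders.
  have e1 : (inner ℝ (fderiv ℝ g v τ) (w - v) : ℝ) = inner ℝ (P v) (fderiv ℝ g v (w - v))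
      - ∑ α, inner ℝ (fderiv ℝ g v (σ α)) (fderiv ℝ (f α) v (w - v)) := by
    rw [hs.hessian_symm, hτ, inner_sub_right, inner_sum, real_inner_comm]
    congr 1
    exact Finset.sum_congr rfl fun α _ => hs.flux_symm α v _ _
  have e2 : ∀ α, -(inner ℝ (fderiv ℝ g v (σ α)) (f α w - f α v - fderiv ℝ (f α) v (w - v)) : ℝ)
      ≤ |B| * C₂ α * relEntropy H g w v := by
    intro α
    refine (neg_le_abs _).trans ((abs_real_inner_le_norm _ _).trans ?_)
    rw [mul_assoc]
    exact mul_le_mul ((hσ α).trans (le_abs_self B)) (h₂ α w v hv) (norm_nonneg _) (abs_nonneg _)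
  have e3 := Finset.sum_le_sum fun α (_ : α ∈ Finset.univ) => e2 α
  have e4 := h₁ w v hv
  simp only [inner_sub_right _ (f _ w - f _ v), Finset.sum_neg_distrib,
    Finset.sum_sub_distrib, ← Finset.sum_mul] at e3
  rw [e1, add_mul]
  rw [inner_sub_left] at e4
  linarith

/-- Averaged form of `exists_relative_rhs_le`. -/
lemma exists_averaged_rhs_le (hP : ContDiff ℝ 1 P)
    (hGP : WeaklyDissipative g P ∨ GrowthP g P H) (M B : ℝ) :
    ∃ C, 0 ≤ C ∧ ∀ (v τ : State n) (σ : Fin d → State n) (m : Measure (State n))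
      [IsProbabilityMeasure m], ‖v‖ ≤ M →
      (∀ α, ‖fderiv ℝ g v (σ α)‖ ≤ B) → τ + ∑ α, fderiv ℝ (f α) v (σ α) = P v →
      Integrable (fun w => w) m → (∀ α, Integrable (f α) m) → Integrable P m → Integrable H m →
      Integrable (fun w => (inner ℝ (g w) (P w) : ℝ)) m →
      (∫ w, inner ℝ (g w) (P w) ∂m) - (inner ℝ (fderiv ℝ g v τ) (∫ w, w ∂m)
          + ∑ α, inner ℝ (fderiv ℝ g v (σ α)) (∫ w, f α w ∂m) + inner ℝ (g v) (∫ w, P w ∂m))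
          + inner ℝ (fderiv ℝ g v τ) v + ∑ α, inner ℝ (fderiv ℝ g v (σ α)) (f α v)
        ≤ C * ∫ w, relEntropy H g w v ∂m := by
  obtain ⟨C, hC, h⟩ := hs.exists_relative_rhs_le hP hGP M B
  refine ⟨C, hC, fun v τ σ m _ hv hσ heq i1 i2 i3 i4 i5 => ?_⟩
  have j1 : Integrable (fun w => w - v) m := i1.sub (integrable_const _)
  have j2 : ∀ α, Integrable (fun w => f α w - f α v) m := fun α => (i2 α).sub (integrable_const _)
  have k1 := j1.const_inner (𝕜 := ℝ) (fderiv ℝ g v τ)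
  have k2 : Integrable (fun w => ∑ α, (inner ℝ (fderiv ℝ g v (σ α)) (f α w - f α v) : ℝ)) m :=
    integrable_finsetSum _ fun α _ => (j2 α).const_inner (𝕜 := ℝ) (fderiv ℝ g v (σ α))
  have k3 := i3.const_inner (𝕜 := ℝ) (g v)
  have key := integral_mono (((i5.sub k1).sub k2).sub k3)
    ((integrable_relEntropy v i1 i4).const_mul C) (h v τ σ hv hσ heq)
  have s1 := integral_sub ((i5.sub k1).sub k2) k3
  have s2 := integral_sub (i5.sub k1) k2
  have s3 := integral_sub i5 k1
  simp only [Pi.sub_apply] at s1 s2 s3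
  rw [integral_const_mul] at key
  simp only [Pi.sub_apply] at key
  rw [s1, s2, s3, integral_finsetSum _ fun α _ => (j2 α).const_inner (𝕜 := ℝ) _, integral_inner j1,
    integral_inner i3, integral_sub i1 (integrable_const _)] at key
  simp_rw [fun α => integral_inner (𝕜 := ℝ) (j2 α) (fderiv ℝ g v (σ α)),
    fun α => integral_sub (i2 α) (integrable_const (f α v)), inner_sub_right,
    Finset.sum_sub_distrib] at key
  simp only [integral_const, probReal_univ, one_smul] at key
  linarith

end

end ConservedStructure

/-! ### Weak differential inequality for the averaged relative entropy. -/

section Uniqueness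

variable {n d : ℕ}

lemma exists_lipschitzWith_comp {W : Type*} [NormedAddCommGroup W] [NormedSpace ℝ W]
    {h : State n → W} (hh : ContDiff ℝ 1 h) {V : Torus d → ℝ → State n} {K : ℝ≥0} {M : ℝ}
    (hV : LipschitzWith K (fun z : Torus d × ℝ => V z.1 z.2)) (hM : ∀ x t, ‖V x t‖ ≤ M) :
    ∃ K' : ℝ≥0, LipschitzWith K' (fun z : Torus d × ℝ => h (V z.1 z.2)) := by
  obtain ⟨L, hL, hlip⟩ := exists_lipschitz_on_ball hh M
  refine ⟨L.toNNReal * K, LipschitzWith.of_dist_le_mul fun z w => ?_⟩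
  rw [dist_eq_norm]
  refine (hlip _ _ (hM _ _) (hM _ _)).trans ?_
  rw [NNReal.coe_mul, Real.coe_toNNReal L hL, mul_assoc, ← dist_eq_norm]
  exact mul_le_mul_of_nonneg_left (hV.dist_le_mul z w) hL

lemma avg_relEntropy {μ : Kernel (Torus d × ℝ) (State n)} [IsMarkovKernel μ] {H : State n → ℝ}
    {g : State n → State n} {z : Torus d × ℝ} (v : State n)
    (h1 : Integrable (fun w => w) (μ z)) (h2 : Integrable H (μ z)) :
    avg μ (fun w => relEntropy H g w v) z
      = avg μ H z - inner ℝ (g v) (avg μ (fun w => w) z) + (inner ℝ (g v) v - H v) :=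
  integral_relEntropy v h1 h2

variable {T : ℝ} {f : Fin d → State n → State n} {H : State n → ℝ}
  {q : Fin d → State n → ℝ} {g P : State n → State n} {μ : Kernel (Torus d × ℝ) (State n)}
  {V : Torus d → ℝ → State n} {K : ℝ≥0} {M : ℝ}

lemma ae_restrict_cyl_of_forall_lt {p : Torus d × ℝ → Prop}
    (h : ∀ T' < T, ∀ᵐ z ∂(volume.restrict (cyl d T')), p z) :
    ∀ᵐ z ∂(volume.restrict (cyl d T)), p z := by
  have h1 : ∀ k : ℕ, ∀ᵐ z, z ∈ cyl d (T - 1 / ((k : ℝ) + 1)) → p z := fun k =>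
    (ae_restrict_iff' (measurableSet_cyl _)).1 (h _ (sub_lt_self _ (by positivity)))
  rw [ae_restrict_iff' (measurableSet_cyl T)]
  filter_upwards [ae_all_iff.2 h1] with z hz hzT
  obtain ⟨k, hk⟩ := exists_nat_one_div_lt (sub_pos.2 hzT.2.2)
  exact hz k ⟨mem_univ _, hzT.2.1, by linarith⟩

/-- The averaged relative entropy is locally integrable. -/
lemma integrable_avg_relEntropy [IsMarkovKernel μ] (hg : ContDiff ℝ 1 g) (hHc : Continuous H)
    (hV : LipschitzWith K (fun z : Torus d × ℝ => V z.1 z.2)) (hM : ∀ x t, ‖V x t‖ ≤ M)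
    (h1 : AvgIntegrable (volume.restrict (cyl d T)) μ (fun w => w))
    (h2 : AvgIntegrable (volume.restrict (cyl d T)) μ H) :
    Integrable (fun z => avg μ (fun w => relEntropy H g w (V z.1 z.2)) z)
      (volume.restrict (cyl d T)) := by
  obtain ⟨C, hC, hgC⟩ := exists_norm_le_on_ball hg.continuous M
  obtain ⟨C', hC', hψ⟩ := exists_norm_le_on_ball (h := fun v => (inner ℝ (g v) v : ℝ) - H v)
    ((hg.continuous.inner continuous_id).sub hHc) M
  have hgm : Continuous fun z : Torus d × ℝ => g (V z.1 z.2) := hg.continuous.comp hV.continuous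
  have i1 : Integrable (fun z : Torus d × ℝ =>
      (inner ℝ (g (V z.1 z.2)) (avg μ (fun w => w) z) : ℝ)) (volume.restrict (cyl d T)) := by
    refine (h1.2.norm.const_mul C).mono'
      (hgm.aestronglyMeasurable.inner h1.2.aestronglyMeasurable) (.of_forall fun z => ?_)
    exact (norm_inner_le_norm _ _).trans
      (mul_le_mul_of_nonneg_right (hgC _ (hM _ _)) (norm_nonneg _))
  have i2 : Integrable (fun z : Torus d × ℝ =>
      (inner ℝ (g (V z.1 z.2)) (V z.1 z.2) : ℝ) - H (V z.1 z.2)) (volume.restrict (cyl d T)) := by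
    refine Integrable.of_bound ?_ C' (.of_forall fun z => hψ _ (hM _ _))
    exact ((hgm.inner hV.continuous).sub (hHc.comp hV.continuous)).aestronglyMeasurable
  refine ((h2.2.sub i1).add i2).congr ?_
  filter_upwards [h1.1, h2.1] with z hz1 hz2
  exact (avg_relEntropy _ hz1 hz2).symm

/-- Differential inequality for the averaged relative entropy, in weak form. -/
lemma exists_relEntropy_inequality (hT : 0 < T) (hs : ConservedStructure f H q g)
    (hP : ContDiff ℝ 1 P) (hGP : WeaklyDissipative g P ∨ GrowthP g P H) [IsMarkovKernel μ]
    {γ : Measure (Torus d × ℝ)}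
    (iid : ∀ T' < T, AvgIntegrable (volume.restrict (cyl d T')) μ (fun w => w))
    (iH : ∀ T' < T, AvgIntegrable (volume.restrict (cyl d T')) μ H)
    (iF : ∀ T' < T, ∀ α, AvgIntegrable (volume.restrict (cyl d T')) μ (f α))
    (iP : ∀ T' < T, AvgIntegrable (volume.restrict (cyl d T')) μ P)
    (iGP : ∀ T' < T, AvgIntegrable (volume.restrict (cyl d T')) μ
      (fun w => (inner ℝ (g w) (P w) : ℝ)))
    (hbal : IsWeakBalance T (avg μ (fun w => w)) (fun α => avg μ (f α)) (avg μ P)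
      (fun x => V x 0))
    (hent : ∀ ξ : ℝ → ℝ, IsTimeTest T ξ →
      0 ≤ (∫ z in cyl d T, deriv ξ z.2 * avg μ H z) + (∫ z in cyl d T, deriv ξ z.2 ∂γ)
        + ξ 0 * (∫ x, H (V x 0))
        + (∫ z in cyl d T, ξ z.2 * avg μ (fun w => (inner ℝ (g w) (P w) : ℝ)) z))
    (hV : LipschitzWith K (fun z : Torus d × ℝ => V z.1 z.2)) (hM : ∀ x t, ‖V x t‖ ≤ M)
    (heqn : ∀ᵐ z ∂(volume.restrict (cyl d T)),
      deriv (V z.1) z.2 + ∑ α, pderiv α (fun y => f α (V y z.2)) z.1 = P (V z.1 z.2)) :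
    ∃ C, 0 ≤ C ∧ ∀ ξ : ℝ → ℝ, IsTimeTest T ξ →
      0 ≤ (∫ z in cyl d T, (deriv ξ z.2 + C * ξ z.2)
          * avg μ (fun w => relEntropy H g w (V z.1 z.2)) z)
        + ∫ z in cyl d T, deriv ξ z.2 ∂γ := by
  have hg1 : ContDiff ℝ 1 g := hs.contDiff_g.of_le one_le_two
  obtain ⟨KΓ, hΓ⟩ := exists_lipschitzWith_comp hg1 hV hM
  obtain ⟨MΓ, -, hMΓ⟩ := exists_norm_le_on_ball hg1.continuous M
  obtain ⟨Kψ, hψ⟩ := exists_lipschitzWith_comp hs.contDiff_dual hV hM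
  obtain ⟨Mψ, -, hMψ⟩ := exists_norm_le_on_ball hs.contDiff_dual.continuous M
  choose Kχ hχ using fun α => exists_lipschitzWith_comp (hs.contDiff_dualFlux α) hV hM
  -- The Lipschitz constant `KΓ` of `g(V)` bounds its spatial derivatives `Dg(V) ∂_α V`.
  obtain ⟨C, hC, hrhs⟩ := hs.exists_averaged_rhs_le hP hGP M KΓ
  refine ⟨C, hC, fun ξ hξ => ?_⟩
  obtain ⟨T₁, hT₁, hsupp⟩ := hξ.support
  obtain ⟨T', hT', hTT⟩ := exists_between hT₁
  have hξ' := hξ.contDiff.continuous_deriv le_rfl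
  obtain ⟨C₀, hC₀, b0⟩ := exists_bound_Ico hξ.contDiff.continuous T'
  obtain ⟨C₁, hC₁, b1⟩ := exists_bound_Ico hξ' T'
  have z0 : ∀ t, T' ≤ t → ξ t = 0 := fun t ht => hsupp t (hT'.le.trans ht)
  have z1 : ∀ t, T' ≤ t → deriv ξ t = 0 := fun t ht =>
    deriv_eq_zero_of_support hsupp (hT'.trans_le ht)
  have m0 : Measurable fun z : Torus d × ℝ => ξ z.2 :=
    (hξ.contDiff.continuous.comp continuous_snd).measurable
  have m1 : Measurable fun z : Torus d × ℝ => deriv ξ z.2 :=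
    (hξ'.comp continuous_snd).measurable
  -- integrability of the terms
  have j1 : Integrable (fun z => deriv ξ z.2 * avg μ H z) (volume.restrict (cyl d T)) :=
    integrable_cyl_smul (T := T) (iH T' hTT).2 (w := fun z => deriv ξ z.2) m1
      (fun z hz => b1 z.2 hz.2) (fun z hz => z1 z.2 hz)
  have j2 : Integrable (fun z => ξ z.2 * avg μ (fun w => (inner ℝ (g w) (P w) : ℝ)) z)
      (volume.restrict (cyl d T)) :=
    integrable_cyl_smul (T := T) (iGP T' hTT).2 (w := fun z => ξ z.2) m0
      (fun z hz => b0 z.2 hz.2) (fun z hz => z0 z.2 hz)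
  -- The balance law is tested with `ξ g(V)`. The identities `e4` and `e5` for the dual entropy and
  -- dual fluxes of `V` supply the terms depending on `V` alone; the flux integrals vanish, so
  -- adding them is free.
  obtain ⟨j3, e3⟩ := hbal.lipschitz_test_inner hξ.contDiff hξ.support
    (Γ := fun x t => g (V x t)) hΓ (fun x t => hMΓ _ (hM x t))
  have j4 := integrable_cyl_deriv_mul (f := fun x t => (inner ℝ (g (V x t)) (V x t) : ℝ)
    - H (V x t)) hψ (fun x t => hMψ _ (hM x t)) hξ.contDiff T
  have e4 := integral_cyl_deriv_mul (f := fun x t => (inner ℝ (g (V x t)) (V x t) : ℝ)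
    - H (V x t)) hψ (fun x t => hMψ _ (hM x t)) hξ.contDiff hT.le (hsupp T hT₁.le)
  have j5 := fun α => integrable_cyl_mul_pderiv
    (f := fun x t => (inner ℝ (g (V x t)) (f α (V x t)) : ℝ) - q α (V x t)) (hχ α)
    hξ.contDiff.continuous T α
  have e5 := fun α => integral_cyl_mul_pderiv
    (f := fun x t => (inner ℝ (g (V x t)) (f α (V x t)) : ℝ) - q α (V x t)) (hχ α) ξ T α
  have j5' := integrable_finsetSum (Finset.univ : Finset (Fin d)) fun α _ => j5 α
  have j6 : Integrable (fun z : Torus d × ℝ => (deriv ξ z.2 + C * ξ z.2)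
      * avg μ (fun w => relEntropy H g w (V z.1 z.2)) z) (volume.restrict (cyl d T)) := by
    refine integrable_cyl_smul (T := T) (C := C₁ + C * C₀)
      (integrable_avg_relEntropy hg1 hs.continuous_H hV hM (iid T' hTT) (iH T' hTT))
      (w := fun z => deriv ξ z.2 + C * ξ z.2) (m1.add (m0.const_mul C)) (fun z hz => ?_)
      (fun z hz => by simp [z0 z.2 hz, z1 z.2 hz])
    refine (abs_add_le _ _).trans (add_le_add (b1 z.2 hz.2) ?_)
    rw [abs_mul, abs_of_nonneg hC]
    exact mul_le_mul_of_nonneg_left (b0 z.2 hz.2) hC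
  -- the pointwise inequality
  have hpt := integral_mono_ae ((((j1.add j2).sub j3).add j4).add j5') j6 (by
    have aeid := ae_restrict_cyl_of_forall_lt fun T' h => (iid T' h).1
    have aeH := ae_restrict_cyl_of_forall_lt fun T' h => (iH T' h).1
    have aeF := ae_restrict_cyl_of_forall_lt fun T' h => ae_all_iff.2 fun α => (iF T' h α).1
    have aeP := ae_restrict_cyl_of_forall_lt fun T' h => (iP T' h).1
    have aeGP := ae_restrict_cyl_of_forall_lt fun T' h => (iGP T' h).1
    filter_upwards [aeid, aeH, aeF, aeP, aeGP, heqn,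
      ae_restrict_of_ae (ae_differentiableAt_lines hV),
      ae_restrict_mem (measurableSet_cyl T)] with z a1 a2 a3 a4 a5 a6 ⟨dt, dx⟩ hz
    have dxc : ∀ {W : Type} [NormedAddCommGroup W] [NormedSpace ℝ W] {h : State n → W},
        Differentiable ℝ h → ∀ α, pderiv α (fun y => h (V y z.2)) z.1
          = fderiv ℝ h (V z.1 z.2) (pderiv α (fun y => V y z.2) z.1) :=
      fun hh α => pderiv_comp (v := fun y => V y z.2) (hh _) (dx α)
    have dtc : ∀ {W : Type} [NormedAddCommGroup W] [NormedSpace ℝ W] {h : State n → W},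
        Differentiable ℝ h → deriv (fun t => h (V z.1 t)) z.2
          = fderiv ℝ h (V z.1 z.2) (deriv (V z.1) z.2) :=
      fun hh => ((hh _).hasFDerivAt.comp_hasDerivAt z.2 dt.hasDerivAt).deriv
    have hb : ∀ α, ‖fderiv ℝ g (V z.1 z.2) (pderiv α (fun y => V y z.2) z.1)‖ ≤ KΓ := by
      intro α
      rw [← dxc hs.differentiable_g α]
      exact norm_pderiv_le (lipschitzWith_space (f := fun x t => g (V x t)) hΓ z.2) α z.1
    have heq : deriv (V z.1) z.2
        + ∑ α, fderiv ℝ (f α) (V z.1 z.2) (pderiv α (fun y => V y z.2) z.1)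
        = P (V z.1 z.2) := by
      rw [← a6]
      congr 1
      exact Finset.sum_congr rfl fun α _ =>
        (dxc ((hs.contDiff_f α).differentiable two_ne_zero) α).symm
    have main := hrhs (V z.1 z.2) (deriv (V z.1) z.2) (fun α => pderiv α (fun y => V y z.2) z.1)
      (μ z) (hM _ _) hb heq a1 a3 a4 a2 a5
    have hrel := avg_relEntropy (g := g) (V z.1 z.2) a1 a2
    have d1 := dtc (hs.contDiff_dual.differentiable one_ne_zero)
    have d2 := fun α => dxc ((hs.contDiff_dualFlux α).differentiable one_ne_zero) α
    rw [(hs.hasFDerivAt_dual _).fderiv] at d1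
    simp only [fun α => (hs.hasFDerivAt_dualFlux α (V z.1 z.2)).fderiv] at d2
    simp only [ContinuousLinearMap.comp_apply, innerSL_apply_apply] at d1 d2
    simp only [Pi.add_apply, Pi.sub_apply]
    rw [d1, dtc hs.differentiable_g]
    simp only [d2, dxc hs.differentiable_g, ← Finset.mul_sum]
    simp only [real_inner_comm (fderiv ℝ g (V z.1 z.2) _) (V z.1 z.2),
      real_inner_comm (fderiv ℝ g (V z.1 z.2) _) (f _ (V z.1 z.2))]
    have hfin := mul_le_mul_of_nonneg_left main (hξ.nonneg z.2 hz.2.1)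
    change _ ≤ _ * (_ * avg μ (fun w => relEntropy H g w (V z.1 z.2)) z) at hfin
    rw [add_mul, mul_assoc C, mul_left_comm C]
    -- Only the copy multiplied by `ξ'` is expanded into moments; the one multiplied by `Cξ` is
    -- matched by `hfin`.
    nth_rewrite 1 [hrel]
    simp only [avg] at hfin ⊢
    linarith)
  have s1 := integral_add (((j1.add j2).sub j3).add j4) j5'
  have s2 := integral_add ((j1.add j2).sub j3) j4
  have s3 := integral_sub (j1.add j2) j3
  have s4 := integral_add j1 j2
  simp only [Pi.add_apply, Pi.sub_apply] at s1 s2 s3 s4 hpt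
  have h0 : ∫ x : Torus d, ((inner ℝ (g (V x 0)) (V x 0) : ℝ) - H (V x 0))
      = (∫ x : Torus d, (inner ℝ (g (V x 0)) (V x 0) : ℝ)) - ∫ x : Torus d, H (V x 0) := by
    have hc : Continuous fun x : Torus d => V x 0 :=
      hV.continuous.comp (continuous_id.prodMk continuous_const)
    have hint : ∀ {h : Torus d → ℝ}, Continuous h → Integrable h := by
      intro h hh
      obtain ⟨B, hB⟩ := isCompact_univ.exists_bound_of_continuousOn hh.continuousOn
      exact Integrable.of_bound hh.aestronglyMeasurable B (.of_forall fun x => hB x (mem_univ x))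
    exact integral_sub (hint ((hg1.continuous.comp hc).inner hc))
      (hint (hs.continuous_H.comp hc))
  rw [h0] at e4
  rw [s1, s2, s3, s4, e4, integral_finsetSum _ fun α _ => j5 α] at hpt
  simp only [e5, Finset.sum_const_zero, add_zero] at hpt
  -- The initial terms `ξ(0) ∫ g(V)·V` from `e3` and `e4` cancel, and what remains is exactly the
  -- `ξ(0) ∫ H(V)` of the entropy inequality.
  have he := hent ξ hξ
  rw [mul_sub] at hpt
  linarith

end Uniqueness

/-! ### Gronwall argument with a time weight, Dirac masses, and change of variables for Young
measures. -/

section Conclusion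

variable {n d : ℕ} {T : ℝ}

/-- The square makes the truncation at `T'` continuously differentiable, hence an admissible test
function. -/
lemma hasDerivAt_max_sq (s : ℝ) : HasDerivAt (fun s : ℝ => (max s 0) ^ 2) (2 * max s 0) s := by
  rcases lt_trichotomy s 0 with h | rfl | h
  · have h1 : (fun s : ℝ => (max s 0) ^ 2) =ᶠ[𝓝 s] fun _ => 0 := by
      filter_upwards [gt_mem_nhds h] with r hr
      simp [max_eq_right hr.le]
    rw [max_eq_right h.le, mul_zero]
    exact (hasDerivAt_const s (0 : ℝ)).congr_of_eventuallyEq h1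
  · rw [max_self, mul_zero, hasDerivAt_iff_isLittleO_nhds_zero]
    have h1 : (fun h : ℝ => h ^ 2) =o[𝓝 0] fun h => h := isLittleO_pow_id one_lt_two
    refine IsBigO.trans_isLittleO (IsBigO.of_bound 1 (.of_forall fun h => ?_)) h1
    simp only [zero_add, max_self, smul_zero, sub_zero, one_mul, norm_pow, Real.norm_eq_abs,
      ne_eq, OfNat.ofNat_ne_zero, not_false_eq_true, zero_pow]
    refine pow_le_pow_left₀ (abs_nonneg _) ?_ 2
    rw [abs_of_nonneg (le_max_right h 0)]
    exact max_le (le_abs_self h) (abs_nonneg h)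
  · have h1 : (fun s : ℝ => (max s 0) ^ 2) =ᶠ[𝓝 s] fun s => s ^ 2 := by
      filter_upwards [lt_mem_nhds h] with r hr
      simp [max_eq_left hr.le]
    rw [max_eq_left h.le]
    simpa using (hasDerivAt_pow 2 s).congr_of_eventuallyEq h1

/-- The time weight `e^{-Ct} ((T' - t)⁺)²`. -/
noncomputable def timeWeight (C T' t : ℝ) : ℝ := Real.exp (-(C * t)) * (max (T' - t) 0) ^ 2

/-- The exponential is chosen so that `ξ' + Cξ = -2e^{-Ct}(T' - t)⁺`, strictly negative before `T'`.
-/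
lemma hasDerivAt_timeWeight (C T' t : ℝ) :
    HasDerivAt (timeWeight C T')
      (-(C * timeWeight C T' t) - 2 * Real.exp (-(C * t)) * max (T' - t) 0) t := by
  have h1 : HasDerivAt (fun t : ℝ => Real.exp (-(C * t))) (Real.exp (-(C * t)) * -(C * 1)) t :=
    (((hasDerivAt_id t).const_mul C).neg).exp
  have h2 : HasDerivAt (fun t : ℝ => (max (T' - t) 0) ^ 2) (2 * max (T' - t) 0 * -1) t :=
    (hasDerivAt_max_sq (T' - t)).comp t ((hasDerivAt_id t).const_sub T')
  refine (h1.mul h2).congr_deriv ?_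
  simp only [timeWeight]
  ring

lemma isTimeTest_timeWeight (C : ℝ) {T' : ℝ} (hT : T' < T) : IsTimeTest T (timeWeight C T') := by
  refine ⟨?_, ⟨T', hT, fun t ht => ?_⟩, fun t _ => ?_⟩
  · rw [contDiff_one_iff_deriv]
    refine ⟨fun t => (hasDerivAt_timeWeight C T' t).differentiableAt, ?_⟩
    have h : deriv (timeWeight C T') = fun t =>
        -(C * timeWeight C T' t) - 2 * Real.exp (-(C * t)) * max (T' - t) 0 :=
      funext fun t => (hasDerivAt_timeWeight C T' t).deriv
    rw [h]
    unfold timeWeight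
    fun_prop
  · simp [timeWeight, max_eq_right (sub_nonpos.2 ht)]
  · unfold timeWeight
    positivity

/-- A nonnegative function satisfying a homogeneous differential inequality with zero initial value,
in weak form and up to a concentration measure, vanishes. -/
lemma ae_eq_zero_of_weak_inequality {R : Torus d × ℝ → ℝ} {γ : Measure (Torus d × ℝ)} {C : ℝ}
    (hC : 0 ≤ C) (hR : ∀ T' < T, Integrable R (volume.restrict (cyl d T')))
    (hR0 : ∀ z, 0 ≤ R z)
    (hineq : ∀ ξ : ℝ → ℝ, IsTimeTest T ξ →
      0 ≤ (∫ z in cyl d T, (deriv ξ z.2 + C * ξ z.2) * R z) + ∫ z in cyl d T, deriv ξ z.2 ∂γ) :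
    ∀ᵐ z ∂(volume.restrict (cyl d T)), R z = 0 := by
  refine ae_restrict_cyl_of_forall_lt fun T' hT => ?_
  have hw0 : ∀ t, 0 ≤ 2 * Real.exp (-(C * t)) * max (T' - t) 0 := fun t => by positivity
  have hd : ∀ t, deriv (timeWeight C T') t
      = -(C * timeWeight C T' t) - 2 * Real.exp (-(C * t)) * max (T' - t) 0 := fun t =>
    (hasDerivAt_timeWeight C T' t).deriv
  -- The weight is nonincreasing since `C ≥ 0`, so concentration can only help; no bound on `γ`
  -- enters.
  have hγ : ∫ z in cyl d T, deriv (timeWeight C T') z.2 ∂γ ≤ 0 := by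
    refine integral_nonpos fun z => ?_
    have h1 : 0 ≤ C * timeWeight C T' z.2 := mul_nonneg hC (by unfold timeWeight; positivity)
    have h2 := hw0 z.2
    rw [hd]
    simp only [Pi.zero_apply]
    linarith
  have hint : ∫ z in cyl d T, (2 * Real.exp (-(C * z.2)) * max (T' - z.2) 0) * R z ≤ 0 := by
    have h1 := hineq _ (isTimeTest_timeWeight C hT)
    have h2 : ∀ z : Torus d × ℝ, (deriv (timeWeight C T') z.2 + C * timeWeight C T' z.2) * R z
        = -((2 * Real.exp (-(C * z.2)) * max (T' - z.2) 0) * R z) := fun z => by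
      rw [hd]; ring
    simp only [h2, integral_neg] at h1
    linarith
  have hcont : Continuous fun t : ℝ => 2 * Real.exp (-(C * t)) * max (T' - t) 0 := by fun_prop
  obtain ⟨B, -, hB⟩ := exists_bound_Ico hcont T'
  have hwR : Integrable (fun z : Torus d × ℝ =>
      (2 * Real.exp (-(C * z.2)) * max (T' - z.2) 0) * R z) (volume.restrict (cyl d T)) :=
    integrable_cyl_smul (T := T) (hR T' hT)
      (w := fun z => 2 * Real.exp (-(C * z.2)) * max (T' - z.2) 0)
      (hcont.comp continuous_snd).measurable (fun z hz => hB z.2 hz.2)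
      (fun z hz => by simp [max_eq_right (sub_nonpos.2 hz)])
  have hzero := (integral_eq_zero_iff_of_nonneg (fun z => mul_nonneg (hw0 z.2) (hR0 z)) hwR).1
    (le_antisymm hint (integral_nonneg fun z => mul_nonneg (hw0 z.2) (hR0 z)))
  filter_upwards [ae_restrict_of_ae_restrict_of_subset (cyl_subset_cyl hT.le) hzero,
    ae_restrict_mem (measurableSet_cyl T')] with z hz hzT
  have hpos : 0 < 2 * Real.exp (-(C * z.2)) * max (T' - z.2) 0 := by
    have : 0 < max (T' - z.2) 0 := lt_max_of_lt_left (sub_pos.2 hzT.2.2)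
    positivity
  exact (mul_eq_zero.1 hz).resolve_left hpos.ne'

/-- A probability measure with vanishing mean relative entropy is a Dirac mass. -/
lemma ConservedStructure.eq_dirac_of_integral_relEntropy_eq_zero
    {f : Fin d → State n → State n} {H : State n → ℝ} {q : Fin d → State n → ℝ}
    {g : State n → State n} (hs : ConservedStructure f H q g) {m : Measure (State n)}
    [IsProbabilityMeasure m] {v : State n} (h1 : Integrable (fun w => w) m) (h2 : Integrable H m)
    (h0 : ∫ w, relEntropy H g w v ∂m = 0) : m = Measure.dirac v := by
  have h3 := (integral_eq_zero_iff_of_nonneg (fun w => hs.relEntropy_nonneg w v)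
    (integrable_relEntropy v h1 h2)).1 h0
  have h4 : (fun w : State n => w) =ᵐ[m] fun _ => v := by
    filter_upwards [h3] with w hw using hs.eq_of_relEntropy_eq_zero hw
  have h5 : m.map (fun w : State n => w) = m.map fun _ => v := Measure.map_congr h4
  rw [Measure.map_const, measure_univ, one_smul] at h5
  rw [← h5]
  exact Measure.map_id'.symm

section Pushforward

variable {X : Type*} [MeasurableSpace X] {ν : Kernel X (State n)} {e : State n ≃ₜ State n}
  {W : Type*} [NormedAddCommGroup W] [NormedSpace ℝ W]

lemma avg_map_homeomorph (f : State n → W) : avg (ν.map e) f = avg ν (f ∘ e) := by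
  ext z
  rw [avg, Kernel.map_apply _ e.continuous.measurable]
  exact e.measurableEmbedding.integral_map f

lemma avgIntegrable_map_homeomorph {m : Measure X} {f : State n → W}
    (h : AvgIntegrable m ν (f ∘ e)) : AvgIntegrable m (ν.map e) f := by
  refine ⟨?_, by rw [avg_map_homeomorph]; exact h.2⟩
  filter_upwards [h.1] with z hz
  rw [Kernel.map_apply _ e.continuous.measurable]
  exact e.measurableEmbedding.integrable_map_iff.2 hz

end Pushforward

/-- A function which is Lipschitz on `𝕋ᵈ × [0, T]` coincides there with a bounded, globally Lipschitz
function. -/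
lemma exists_lipschitz_extension (hT : 0 ≤ T) {ubar : Torus d → ℝ → State n} {K : ℝ≥0}
    (h : LipschitzOnWith K (fun z : Torus d × ℝ => ubar z.1 z.2) (univ ×ˢ Icc 0 T)) :
    ∃ (U : Torus d → ℝ → State n) (M : ℝ),
      LipschitzWith K (fun z : Torus d × ℝ => U z.1 z.2) ∧ (∀ x t, ‖U x t‖ ≤ M) ∧
      ∀ x, ∀ t ∈ Icc 0 T, U x t = ubar x t := by
  have hmem : ∀ z : Torus d × ℝ, (z.1, (projIcc 0 T hT z.2 : ℝ)) ∈
      (univ ×ˢ Icc 0 T : Set (Torus d × ℝ)) := fun z => ⟨mem_univ _, (projIcc 0 T hT z.2).2⟩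
  obtain ⟨M, hM⟩ := (isCompact_univ.prod isCompact_Icc).exists_bound_of_continuousOn h.continuousOn
  -- Clamping time to `[0, T]` is 1-Lipschitz, so the constant `K` is kept.
  have hlip : LipschitzWith K (fun z : Torus d × ℝ => ubar z.1 (projIcc 0 T hT z.2)) := by
    refine LipschitzWith.of_dist_le_mul fun z w => ?_
    refine (h.dist_le_mul _ (hmem z) _ (hmem w)).trans (mul_le_mul_of_nonneg_left ?_ K.2)
    rw [Prod.dist_eq, Prod.dist_eq]
    refine max_le_max le_rfl ?_
    have := (LipschitzWith.projIcc hT).dist_le_mul z.2 w.2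
    rwa [NNReal.coe_one, one_mul] at this
  have hbound : ∀ x t, ‖ubar x (projIcc 0 T hT t)‖ ≤ M := fun x t =>
    hM (x, (projIcc 0 T hT t : ℝ)) (hmem (x, t))
  have heq : ∀ x, ∀ t ∈ Icc 0 T, ubar x (projIcc 0 T hT t) = ubar x t := fun x t ht => by
    rw [projIcc_of_mem hT ht]
  exact ⟨fun x t => ubar x (projIcc 0 T hT t), M, hlip, hbound, heq⟩

/-- Time `0` is discarded because the time derivatives of `ū` and of its extension need agree only
at interior times. -/
lemma ae_restrict_cyl_pos : ∀ᵐ z ∂((volume : Measure (Torus d × ℝ)).restrict (cyl d T)),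
    0 < z.2 := by
  have h1 : ∀ᵐ z : Torus d × ℝ, z.2 ≠ 0 := by
    have : Measure.QuasiMeasurePreserving (Prod.snd : Torus d × ℝ → ℝ) :=
      Measure.quasiMeasurePreserving_snd
    exact this.ae (Measure.ae_ne volume 0)
  filter_upwards [ae_restrict_of_ae h1, ae_restrict_mem (measurableSet_cyl T)] with z hz hzT
  exact lt_of_le_of_ne hzT.2.1 hz.symm

end Conclusion

end BalanceLaw

/-! ### The main theorem: passage to conserved variables and back. -/

theorem mainTheorem6 {n d : ℕ} (T p : ℝ) (hT : 0 < T) (hp : 1 < p)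
    (A : BalanceLaw.State n → BalanceLaw.State n)
    (F : Fin d → BalanceLaw.State n → BalanceLaw.State n)
    (P : BalanceLaw.State n → BalanceLaw.State n)
    (η : BalanceLaw.State n → ℝ) (q : Fin d → BalanceLaw.State n → ℝ)
    (G : BalanceLaw.State n → BalanceLaw.State n)
    (hstruct : BalanceLaw.EntropyStructure A F η q G)
    (hgrowth : BalanceLaw.GrowthConditions p A F η)
    (hη : ∀ u, 0 ≤ η u)
    (hP : ContDiff ℝ 1 P)
    (hGP : (BalanceLaw.WeaklyDissipative G P ∧ BalanceLaw.GrowthG G η) ∨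
      (BalanceLaw.GrowthG G η ∧ BalanceLaw.GrowthP G P η))
    (u : BalanceLaw.Torus d → ℝ → BalanceLaw.State n)
    (ν : Kernel (BalanceLaw.Torus d × ℝ) (BalanceLaw.State n))
    (γ : Measure (BalanceLaw.Torus d × ℝ))
    (ν₀ : Kernel (BalanceLaw.Torus d) (BalanceLaw.State n))
    (γ₀ : Measure (BalanceLaw.Torus d))
    (hmv : BalanceLaw.IsDissipativeMVSolution T p A F P η G u ν γ ν₀ γ₀)
    (ubar : BalanceLaw.Torus d → ℝ → BalanceLaw.State n)
    (hstrong : BalanceLaw.IsStrongSolution T A F P ubar)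
    (hγ₀ : γ₀ = 0)
    (hν₀ : ∀ᵐ x : BalanceLaw.Torus d, ν₀ x = Measure.dirac (ubar x 0)) :
    ∀ᵐ z ∂((volume : Measure (BalanceLaw.Torus d × ℝ)).restrict (BalanceLaw.cyl d T)),
      ν z = Measure.dirac (ubar z.1 z.2) ∧ u z.1 z.2 = ubar z.1 z.2 := by
  have := hmv.markov
  obtain ⟨e, heA, he2⟩ := BalanceLaw.exists_homeomorph_A hstruct hgrowth (by linarith)
  have hG : BalanceLaw.GrowthG G η := hGP.elim (fun h => h.2) fun h => h.1
  have hcons := hstruct.conserved hgrowth hη hG heA he2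
  have hse : ∀ w, e.symm (A w) = w := fun w => by rw [← heA]; exact e.symm_apply_apply w
  have htend : Tendsto e.symm (Bornology.cobounded (BalanceLaw.State n))
      (Bornology.cobounded (BalanceLaw.State n)) := by
    rw [Metric.cobounded_eq_cocompact]
    exact e.symm.isClosedEmbedding.tendsto_cocompact
  have hcomp : ∀ {W : Type} (f : BalanceLaw.State n → W), (f ∘ e.symm) ∘ e = f := fun f => by
    ext w; simp
  have hGP' : BalanceLaw.WeaklyDissipative (G ∘ e.symm) (P ∘ e.symm) ∨
      BalanceLaw.GrowthP (G ∘ e.symm) (P ∘ e.symm) (η ∘ e.symm) :=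
    hGP.imp (fun h v w => h.1 _ _)
      (fun h => ⟨h.2.1.comp_tendsto htend, h.2.2.comp_tendsto htend⟩)
  have hP' : ContDiff ℝ 1 (P ∘ e.symm) := hP.comp (he2.of_le one_le_two)
  have hA1 : ContDiff ℝ 1 A := hstruct.contDiff_A.of_le one_le_two
  -- the strong solution in conserved variables
  obtain ⟨K, hK⟩ := hstrong.lipschitz
  obtain ⟨U, M, hU, hUM, hUeq⟩ := BalanceLaw.exists_lipschitz_extension hT.le hK
  obtain ⟨KV, hV⟩ := BalanceLaw.exists_lipschitzWith_comp hA1 hU hUM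
  obtain ⟨MV, -, hMV⟩ := BalanceLaw.exists_norm_le_on_ball hA1.continuous M
  set V : BalanceLaw.Torus d → ℝ → BalanceLaw.State n := fun x t => A (U x t) with hVdef
  have hVM : ∀ x t, ‖V x t‖ ≤ MV := fun x t => hMV _ (hUM x t)
  have hV0 : ∀ x, V x 0 = A (ubar x 0) := fun x => by
    rw [hVdef]; simp only; rw [hUeq x 0 ⟨le_rfl, hT.le⟩]
  have heqn : ∀ᵐ z ∂((volume : Measure (BalanceLaw.Torus d × ℝ)).restrict (BalanceLaw.cyl d T)),
      deriv (V z.1) z.2 + ∑ α, BalanceLaw.pderiv α (fun y => (F α ∘ e.symm) (V y z.2)) z.1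
        = (P ∘ e.symm) (V z.1 z.2) := by
    filter_upwards [hstrong.equation, BalanceLaw.ae_restrict_cyl_pos,
      ae_restrict_mem (BalanceLaw.measurableSet_cyl T)] with z hz hz0 hzT
    have hmem : z.2 ∈ Icc 0 T := ⟨hz0.le, hzT.2.2.le⟩
    -- Equality of the derivatives requires equality on a neighbourhood of the time `z.2`, which
    -- lies in the open interval `(0, T)`.
    have h1 : V z.1 =ᶠ[𝓝 z.2] fun s => A (ubar z.1 s) := by
      filter_upwards [Icc_mem_nhds hz0 hzT.2.2] with s hs
      rw [hVdef]; simp only; rw [hUeq _ s hs]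
    rw [h1.deriv_eq]
    simp only [hVdef, Function.comp_apply, hse, hUeq _ z.2 hmem]
    exact hz
  -- the measure-valued solution in conserved variables
  set μ := ν.map e with hμ
  have hμm : IsMarkovKernel μ := Kernel.IsMarkovKernel.map ν e.continuous.measurable
  have tr : ∀ {W : Type} [NormedAddCommGroup W] [NormedSpace ℝ W]
      (f : BalanceLaw.State n → W), BalanceLaw.avg μ (f ∘ e.symm) = BalanceLaw.avg ν f :=
    fun f => by rw [hμ, BalanceLaw.avg_map_homeomorph, hcomp]
  have trid : BalanceLaw.avg μ (fun w => w) = BalanceLaw.avg ν A := by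
    rw [hμ, BalanceLaw.avg_map_homeomorph, ← heA]; rfl
  have tri : ∀ {m : Measure (BalanceLaw.Torus d × ℝ)} {W : Type} [NormedAddCommGroup W]
      [NormedSpace ℝ W] {f : BalanceLaw.State n → W}, BalanceLaw.AvgIntegrable m ν f →
      BalanceLaw.AvgIntegrable m μ (f ∘ e.symm) := fun h =>
    BalanceLaw.avgIntegrable_map_homeomorph (by rwa [hcomp])
  have iid : ∀ T' < T, BalanceLaw.AvgIntegrable (volume.restrict (BalanceLaw.cyl d T')) μ
      (fun w => w) := fun T' hT' => by
    refine BalanceLaw.avgIntegrable_map_homeomorph ?_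
    have := hmv.integrable_A T' hT'
    rw [← heA] at this
    exact this
  have havA₀ : BalanceLaw.avg ν₀ A =ᵐ[volume] fun x => V x 0 := by
    filter_upwards [hν₀] with x hx
    rw [BalanceLaw.avg, hx, integral_dirac, hV0]
  have havη₀ : BalanceLaw.avg ν₀ η =ᵐ[volume] fun x => (η ∘ e.symm) (V x 0) := by
    filter_upwards [hν₀] with x hx
    rw [BalanceLaw.avg, hx, integral_dirac, hV0, Function.comp_apply, hse]
  have hbal : BalanceLaw.IsWeakBalance T (BalanceLaw.avg μ (fun w => w))
      (fun α => BalanceLaw.avg μ (F α ∘ e.symm)) (BalanceLaw.avg μ (P ∘ e.symm))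
      (fun x => V x 0) := by
    simp only [tr, trid]
    refine ⟨fun T' h => (hmv.integrable_A T' h).2, fun T' h α => (hmv.integrable_F T' h α).2,
      fun T' h => (hmv.integrable_P T' h).2, hmv.integrable_A₀.2.congr havA₀, fun φ hφ => ?_⟩
    rw [← hmv.equation φ hφ]
    congr 1
    refine integral_congr_ae ?_
    filter_upwards [havA₀] with x hx
    rw [hx]
  have hent : ∀ ξ : ℝ → ℝ, BalanceLaw.IsTimeTest T ξ →
      0 ≤ (∫ z in BalanceLaw.cyl d T, deriv ξ z.2 * BalanceLaw.avg μ (η ∘ e.symm) z)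
        + (∫ z in BalanceLaw.cyl d T, deriv ξ z.2 ∂γ)
        + ξ 0 * (∫ x, (η ∘ e.symm) (V x 0))
        + (∫ z in BalanceLaw.cyl d T, ξ z.2 * BalanceLaw.avg μ
          (fun w => (inner ℝ ((G ∘ e.symm) w) ((P ∘ e.symm) w) : ℝ)) z) := by
    intro ξ hξ
    have h1 := hmv.entropy ξ hξ
    -- Both hypotheses on the data act here: no initial concentration, and the initial averaged
    -- entropy is that of the strong solution.
    rw [hγ₀, measureReal_zero_apply, add_zero, integral_congr_ae havη₀] at h1
    rw [tr, show (fun w => (inner ℝ ((G ∘ e.symm) w) ((P ∘ e.symm) w) : ℝ))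
      = (fun w => (inner ℝ (G w) (P w) : ℝ)) ∘ e.symm from rfl, tr]
    exact h1
  obtain ⟨C, hC, hineq⟩ := BalanceLaw.exists_relEntropy_inequality hT hcons hP' hGP' iid
    (fun T' h => tri (hmv.integrable_η T' h)) (fun T' h α => tri (hmv.integrable_F T' h α))
    (fun T' h => tri (hmv.integrable_P T' h)) (fun T' h => tri (hmv.integrable_GP T' h))
    hbal hent hV hVM heqn
  have hRint : ∀ T' < T, Integrable (fun z : BalanceLaw.Torus d × ℝ => BalanceLaw.avg μ
      (fun w => BalanceLaw.relEntropy (η ∘ e.symm) (G ∘ e.symm) w (V z.1 z.2)) z)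
      (volume.restrict (BalanceLaw.cyl d T')) := fun T' h =>
    BalanceLaw.integrable_avg_relEntropy (hcons.contDiff_g.of_le one_le_two)
      hcons.continuous_H hV hVM (iid T' h) (tri (hmv.integrable_η T' h))
  have hRnonneg : ∀ z : BalanceLaw.Torus d × ℝ, 0 ≤ BalanceLaw.avg μ
      (fun w => BalanceLaw.relEntropy (η ∘ e.symm) (G ∘ e.symm) w (V z.1 z.2)) z := fun z =>
    integral_nonneg fun w => hcons.relEntropy_nonneg w (V z.1 z.2)
  have hzero := BalanceLaw.ae_eq_zero_of_weak_inequality (R := fun z => BalanceLaw.avg μ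
    (fun w => BalanceLaw.relEntropy (η ∘ e.symm) (G ∘ e.symm) w (V z.1 z.2)) z)
    hC hRint hRnonneg hineq
  filter_upwards [hzero, BalanceLaw.ae_restrict_cyl_of_forall_lt fun T' h => (iid T' h).1,
    BalanceLaw.ae_restrict_cyl_of_forall_lt fun T' h => (tri (hmv.integrable_η T' h)).1,
    hmv.mean, ae_restrict_mem (BalanceLaw.measurableSet_cyl T)] with z h0 h1 h2 h3 hzT
  have hdirac : μ z = Measure.dirac (V z.1 z.2) :=
    hcons.eq_dirac_of_integral_relEntropy_eq_zero h1 h2 h0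
  have hνz : ν z = Measure.dirac (ubar z.1 z.2) := by
    -- Pushing forward by `A` and then by its inverse returns `ν z`, and a Dirac mass at `A(ū)` goes
    -- to the one at `ū`.
    have h4 : (μ z).map e.symm = ν z := by
      rw [hμ, Kernel.map_apply _ e.continuous.measurable,
        Measure.map_map e.symm.continuous.measurable e.continuous.measurable]
      simp
    rw [← h4, hdirac, Measure.map_dirac' e.symm.continuous.measurable, hVdef]
    simp only [hse]
    rw [hUeq _ z.2 ⟨hzT.2.1, hzT.2.2.le⟩]
  refine ⟨hνz, ?_⟩
  rw [h3.2, BalanceLaw.avg, hνz, integral_dirac]
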